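/- Let $D\subset\mathbb C^n$ be a bounded convex domain (nonempty, open), with Euclidean norm $\|\cdot\|$, and $\delta_D(z)=\inf\{\|z-w\|:w\in\mathbb C^n\setminus D\}$. The Kobayashi–Royden metric is $\kappa_D(z;X)=\inf\{|\alpha| : \alpha\in\mathbb C,\ \exists\,\varphi:\mathbb D\to D \text{ holomorphic},\ \varphi(0)=z,\ \alpha\varphi'(0)=X\}$, and the Kobayashi distance $k_D(x,y)$ is the infimum of $\int_0^1\kappa_D(\gamma(t);\gamma'(t))\,dt$ over all piecewise $\mathcal C^1$ curves $\gamma:[0,1]\to D$ from $x$ to $y$. The Gromov product is $(x|y)_o=\frac12[k_D(x,o)+k_D(o,y)-k_D(x,y)]$. A complex face of $D$ is a nonempty set $L\cap\partial D$, where $L$ is an affine complex line with $L\cap D=\emptyset$; the multiface $F_p$ of $p\in\partial D$ is the union of all complex faces containing $p$. We call $F_p$ trivial if $F_p\subseteq\{p\}$. (If $n\ge2$ then always $p\in F_p$, so this means $F_p=\{p\}$; if $n=1$ then $F_p=\emptyset$ for every $p$.) The log-estimate holds at $(p,q)$ if $$\limsup_{(x,y)\to(p,q),\ x,y\in D}\Big(\tfrac12\log\tfrac1{\delta_D(x)}+\tfrac12\log\tfrac1{\delta_D(y)}-k_D(x,y)\Big)<\infty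 .$$ $D$ has $\frac12$-log-growth if $\sup_{z\in D}\big(k_D(x_0,z)-\frac12\log\frac1{\delta_D(z)}\big)<\infty$ for some $x_0\in D$. A geodesic is a map $\sigma:[0,L]\to D$ with $k_D(\sigma(s),\sigma(t))=|s-t|$ for all $s,t\in[0,L]$. $D$ has the visibility property if $k_D$ is a complete distance on $D$ and, for all $p\ne q$ in $\partial D$, there are neighborhoods $U$ of $p$ and $V$ of $q$ with $\overline U\cap\overline V=\emptyset$ and a compact set $K\subset D$ such that every geodesic $\sigma:[0,L]\to D$ with $\sigma(0)\in U$ and $\sigma(L)\in V$ meets $K$. Then: 1. If $p,q\in\partial D$ satisfy $F_p\cap F_q=\emptyset$ (and, in case $n=1$, also $p\neq q$), then the log-estimate holds at $(p,q)$. If moreover $D$ has $\frac12$-log-growth, then $\limsup_{(x,y)\to(p,q),\ x,y\in D}(x|y)_o<\infty$ for every base point $o\in D$. 2. If $p\in\partial D$ has trivial multiface, then the log-estimate holds at $(p,q)$ for every $q\in\partial D\setminus\{p\}$. 3. If $F_p$ is trivial for every $p\in\partial D$ and $D$ has $\frac12$-log-growth, then $D$ has the visibility property. -/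

import Mathlib

open Set Filter Topology MeasureTheory

noncomputable section

namespace ConvexVisibility

/-- The Kobayashi-Royden (pseudo)metric `κ_D(z; X)`, with values in `[0, ∞]`: the infimum of `|α|`
over the `α ∈ ℂ` and the holomorphic `φ : 𝔻 → D` with `φ(0) = z` and `α φ'(0) = X`. -/
def kobayashiMetric {n : ℕ} (D : Set (EuclideanSpace ℂ (Fin n)))
    (z X : EuclideanSpace ℂ (Fin n)) : ENNReal :=
  sInf {r : ENNReal | ∃ (α : ℂ) (φ : ℂ → EuclideanSpace ℂ (Fin n)),
    DifferentiableOn ℂ φ (Metric.ball 0 1) ∧ MapsTo φ (Metric.ball 0 1) D ∧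
    φ 0 = z ∧ α • deriv φ 0 = X ∧ r = ‖α‖ₑ}

/-- `γ : [0,1] → D` is a piecewise `C¹` curve in `D` from `x` to `y`. -/
structure IsPiecewiseC1Curve {n : ℕ} (D : Set (EuclideanSpace ℂ (Fin n)))
    (x y : EuclideanSpace ℂ (Fin n)) (γ : ℝ → EuclideanSpace ℂ (Fin n)) : Prop where
  mapsTo : MapsTo γ (Icc 0 1) D
  source : γ 0 = x
  target : γ 1 = y
  continuousOn : ContinuousOn γ (Icc 0 1)
  piecewise : ∃ (m : ℕ) (t : ℕ → ℝ), Monotone t ∧ t 0 = 0 ∧ t m = 1 ∧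
    ∀ i < m, ContDiffOn ℝ 1 γ (Icc (t i) (t (i + 1)))

/-- The Kobayashi (pseudo)distance with values in `[0, ∞]`: the infimum of
`∫₀¹ κ_D(γ(t); γ'(t)) dt` over the piecewise `C¹` curves in `D` from `x` to `y`. -/
def kobayashiEDist {n : ℕ} (D : Set (EuclideanSpace ℂ (Fin n)))
    (x y : EuclideanSpace ℂ (Fin n)) : ENNReal :=
  sInf {r : ENNReal | ∃ γ : ℝ → EuclideanSpace ℂ (Fin n), IsPiecewiseC1Curve D x y γ ∧
    r = ∫⁻ t in Icc (0 : ℝ) 1, kobayashiMetric D (γ t) (deriv γ t)}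

/-- The Kobayashi (pseudo)distance `k_D(x, y)` as a real number (the infimum above is finite
for points `x, y` of a connected open set `D`). -/
def kobayashiDist {n : ℕ} (D : Set (EuclideanSpace ℂ (Fin n)))
    (x y : EuclideanSpace ℂ (Fin n)) : ℝ :=
  (kobayashiEDist D x y).toReal

/-- `D` is complete hyperbolic: `k_D` is a distance on `D`, and it is complete. -/
def IsCompleteHyperbolic {n : ℕ} (D : Set (EuclideanSpace ℂ (Fin n))) : Prop :=
  (∀ x ∈ D, ∀ y ∈ D, kobayashiDist D x y = 0 → x = y) ∧
  ∀ u : ℕ → EuclideanSpace ℂ (Fin n), (∀ k, u k ∈ D) →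
    (∀ ε > 0, ∃ N, ∀ k ≥ N, ∀ l ≥ N, kobayashiDist D (u k) (u l) < ε) →
    ∃ z ∈ D, Tendsto (fun k => kobayashiDist D (u k) z) atTop (𝓝 0)

/-- `σ : [0,L] → D` is a geodesic for `k_D`. -/
def IsGeodesic {n : ℕ} (D : Set (EuclideanSpace ℂ (Fin n))) (L : ℝ)
    (σ : ℝ → EuclideanSpace ℂ (Fin n)) : Prop :=
  0 ≤ L ∧ MapsTo σ (Icc 0 L) D ∧
    ∀ s ∈ Icc 0 L, ∀ t ∈ Icc 0 L, kobayashiDist D (σ s) (σ t) = |s - t|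

/-- The pair `{p, q}` has visible geodesics. -/
def HasVisibleGeodesics {n : ℕ} (D : Set (EuclideanSpace ℂ (Fin n)))
    (p q : EuclideanSpace ℂ (Fin n)) : Prop :=
  ∃ U ∈ 𝓝 p, ∃ V ∈ 𝓝 q, closure U ∩ closure V = ∅ ∧
    ∃ K ⊆ D, IsCompact K ∧
      ∀ (L : ℝ) (σ : ℝ → EuclideanSpace ℂ (Fin n)), IsGeodesic D L σ →
        σ 0 ∈ U → σ L ∈ V → (σ '' Icc 0 L ∩ K).Nonempty

/-- `D` has the visibility property (a notion for complete hyperbolic domains). -/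
def HasVisibilityProperty {n : ℕ} (D : Set (EuclideanSpace ℂ (Fin n))) : Prop :=
  IsCompleteHyperbolic D ∧
    ∀ p ∈ frontier D, ∀ q ∈ frontier D, p ≠ q → HasVisibleGeodesics D p q

/-- The Gromov product `(x|y)_o`. -/
def gromovProduct {n : ℕ} (D : Set (EuclideanSpace ℂ (Fin n)))
    (o x y : EuclideanSpace ℂ (Fin n)) : ℝ :=
  (1 / 2) * (kobayashiDist D x o + kobayashiDist D o y - kobayashiDist D x y)

/-- `limsup_{(x,y) → (p,q)} (x|y)_o < ∞`, where `x, y` range over `D`. -/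
def GromovProductBounded {n : ℕ} (D : Set (EuclideanSpace ℂ (Fin n)))
    (o p q : EuclideanSpace ℂ (Fin n)) : Prop :=
  limsup (fun z : EuclideanSpace ℂ (Fin n) × EuclideanSpace ℂ (Fin n) =>
    ((gromovProduct D o z.1 z.2 : ℝ) : EReal)) (𝓝[D] p ×ˢ 𝓝[D] q) < ⊤

/-- `δ_D(z)`, the Euclidean distance of `z` from the complement of `D`. -/
def boundaryDist {n : ℕ} (D : Set (EuclideanSpace ℂ (Fin n)))
    (z : EuclideanSpace ℂ (Fin n)) : ℝ :=
  Metric.infDist z Dᶜ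

/-- The log-estimate at `(p, q)`:
`limsup_{(x,y) → (p,q)} (½ log (1/δ_D(x)) + ½ log (1/δ_D(y)) - k_D(x,y)) < ∞`,
where `x, y` range over `D`. -/
def LogEstimate {n : ℕ} (D : Set (EuclideanSpace ℂ (Fin n)))
    (p q : EuclideanSpace ℂ (Fin n)) : Prop :=
  limsup (fun z : EuclideanSpace ℂ (Fin n) × EuclideanSpace ℂ (Fin n) =>
    (((1 / 2) * Real.log (1 / boundaryDist D z.1) + (1 / 2) * Real.log (1 / boundaryDist D z.2)
      - kobayashiDist D z.1 z.2 : ℝ) : EReal)) (𝓝[D] p ×ˢ 𝓝[D] q) < ⊤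

/-- `D` has `α`-log-growth. -/
def HasLogGrowth {n : ℕ} (D : Set (EuclideanSpace ℂ (Fin n))) (α : ℝ) : Prop :=
  0 < α ∧ ∃ x₀ ∈ D,
    BddAbove ((fun z => kobayashiDist D x₀ z - α * Real.log (1 / boundaryDist D z)) '' D)

/-- `F` is a complex face of `D`: `F = L ∩ ∂D` is nonempty, where `L` is an affine complex line
that does not meet `D`. -/
def IsComplexFace {n : ℕ} (D F : Set (EuclideanSpace ℂ (Fin n))) : Prop :=
  ∃ L : AffineSubspace ℂ (EuclideanSpace ℂ (Fin n)), Module.finrank ℂ L.direction = 1 ∧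
    (L : Set (EuclideanSpace ℂ (Fin n))) ∩ D = ∅ ∧
    ((L : Set (EuclideanSpace ℂ (Fin n))) ∩ frontier D).Nonempty ∧
    F = (L : Set (EuclideanSpace ℂ (Fin n))) ∩ frontier D

/-- The multiface `F_p`: the union of the complex faces of `D` that contain `p`. -/
def multiface {n : ℕ} (D : Set (EuclideanSpace ℂ (Fin n)))
    (p : EuclideanSpace ℂ (Fin n)) : Set (EuclideanSpace ℂ (Fin n)) :=
  ⋃₀ {F | IsComplexFace D F ∧ p ∈ F}

end ConvexVisibility

end

/-!
Let `f` be a norm-one complex functional whose real part is maximised over `D` at `w`. Then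
`z ↦ f (w - z)` maps `D` into the right half-plane, and by the Schwarz lemma `½ log ‖f (w - ·)‖` is
1-Lipschitz for `k_D`. If `w` is a boundary point closest to `x`, then `‖f (w - x)‖ ≤ δ_D(x)`.

Suppose that no complex supporting hyperplane at `p` meets one at `q` inside the closure of `D`.
By compactness there is `c > 0` such that for all `w` near `p`, `w'` near `q` and all `z ∈ D`, one
of `‖f (w - z)‖`, `‖g (w' - z)‖` is at least `c`. So every curve from `x` near `p` to `y` near `q`
passes through a point at which both are at least `c`, and its two halves have length at least
`½ log (c / δ_D(x))` and `½ log (c / δ_D(y))`: this is the log-estimate. Two supporting hyperplanes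
meeting in a point of the closure produce complex lines, hence faces, through that point.

For visibility, a point `z` on a geodesic from `x` to `y` satisfies
`k_D(o, z) ≤ (x|z)_o + (z|y)_o`. The right-hand side stays bounded as `x → p`, `y → q` and `z` tends
to a boundary point other than `p` and `q`, whereas `k_D(o, z) → ∞`.
-/

namespace ConvexVisibility

section Analysis

lemma norm_deriv_zero_le_of_re_pos {h : ℂ → ℂ} {R : ℝ} (hR : 0 < R)
    (hd : DifferentiableOn ℂ h (Metric.ball 0 R))
    (hpos : ∀ ζ ∈ Metric.ball (0 : ℂ) R, 0 < (h ζ).re) : ‖deriv h 0‖ ≤ 2 * (h 0).re / R := by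
  have h0 : (0 : ℂ) ∈ Metric.ball (0 : ℂ) R := Metric.mem_ball_self hR
  have hslope := hasDerivAt_iff_tendsto_slope_zero.1
    (hd.differentiableAt (Metric.isOpen_ball.mem_nhds h0)).hasDerivAt
  have hbound : Tendsto (fun t : ℂ => 2 * (h 0).re / (R - ‖t‖)) (𝓝[≠] 0)
      (𝓝 (2 * (h 0).re / R)) := by
    have hcont : ContinuousAt (fun t : ℂ => 2 * (h 0).re / (R - ‖t‖)) 0 := by
      fun_prop (disch := simpa using hR.ne')
    simpa only [norm_zero, sub_zero] using hcont.tendsto.mono_left nhdsWithin_le_nhds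
  refine le_of_tendsto_of_tendsto hslope.norm hbound ?_
  filter_upwards [nhdsWithin_le_nhds (Metric.ball_mem_nhds 0 hR), self_mem_nhdsWithin]
    with t ht ht0
  have hbc := Complex.borelCaratheodory_zero (f := fun ζ => h 0 - h ζ) (hpos 0 h0)
    (hd.const_sub _) (fun ζ hζ => by simpa using (hpos ζ hζ).le) hR ht (sub_self _)
  rw [zero_add, norm_smul, norm_inv, norm_sub_rev, inv_mul_le_iff₀ (norm_pos_iff.2 ht0)]
  exact hbc.trans_eq (by ring)

lemma enorm_sub_le_lintegral_deriv_of_countable {F : Type*} [NormedAddCommGroup F]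
    [NormedSpace ℝ F] [CompleteSpace F] {f : ℝ → F} {a b : ℝ} (hab : a ≤ b) {s : Set ℝ}
    (hs : s.Countable) (hf : ContinuousOn f (Icc a b))
    (hd : ∀ t ∈ Ioo a b \ s, DifferentiableAt ℝ f t) :
    ‖f b - f a‖ₑ ≤ ∫⁻ t in Icc a b, ‖deriv f t‖ₑ := by
  by_cases htop : ∫⁻ t in Icc a b, ‖deriv f t‖ₑ = ⊤
  · simp [htop]
  have hint : IntegrableOn (deriv f) (Icc a b) :=
    ⟨(stronglyMeasurable_deriv f).aestronglyMeasurable, lt_top_iff_ne_top.2 htop⟩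
  rw [← integral_eq_of_hasDerivAt_off_countable_of_le f (deriv f) hab hs hf
    (fun t ht => (hd t ht).hasDerivAt)
    ((intervalIntegrable_iff_integrableOn_Icc_of_le hab).2 hint),
    intervalIntegral.integral_of_le hab, ← integral_Icc_eq_integral_Ioc]
  exact enorm_integral_le_lintegral_enorm _

lemma limsup_coe_ereal_lt_top_iff {α : Type*} {l : Filter α} {f : α → ℝ} :
    limsup (fun x => (f x : EReal)) l < ⊤ ↔ ∃ C, ∀ᶠ x in l, f x ≤ C := by
  constructor
  · intro h
    obtain ⟨C, hC, -⟩ := EReal.lt_iff_exists_real_btwn.1 h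
    exact ⟨C, (eventually_lt_of_limsup_lt hC).mono fun x hx => (EReal.coe_lt_coe_iff.1 hx).le⟩
  · rintro ⟨C, hC⟩
    exact (limsup_le_of_le (h := hC.mono fun x hx => EReal.coe_le_coe_iff.2 hx)).trans_lt
      (EReal.coe_lt_top C)

lemma convex_setOf_ball_subset {E : Type*} [SeminormedAddCommGroup E] [NormedSpace ℝ E]
    {D : Set E} (hconv : Convex ℝ D) (r : ℝ) : Convex ℝ {z | Metric.ball z r ⊆ D} := by
  have heq : {z | Metric.ball z r ⊆ D} = ⋂ v ∈ Metric.ball (0 : E) r, (fun z => z + v) ⁻¹' D := by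
    ext z
    simp only [mem_ofPred_eq, mem_iInter, mem_preimage]
    refine ⟨fun h v hv => h (by simpa using hv), fun h x hx => ?_⟩
    simpa using h (x - z) (by simpa [dist_eq_norm] using hx)
  rw [heq]
  exact convex_iInter₂ fun v _ => hconv.translate_preimage_left v

end Analysis

section PiecewiseC1

variable {F : Type*} [NormedAddCommGroup F] [NormedSpace ℝ F] {γ : ℝ → F} {a b c : ℝ}

/-- `γ` is of class `C¹` on each of finitely many consecutive closed intervals that fill `[a, b]`.
On `[0, 1]` this is the last condition of `IsPiecewiseC1Curve`; general intervals are needed to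
reverse and concatenate curves. -/
def IsPiecewiseC1On (γ : ℝ → F) (a b : ℝ) : Prop :=
  ∃ (m : ℕ) (t : ℕ → ℝ), Monotone t ∧ t 0 = a ∧ t m = b ∧
    ∀ i < m, ContDiffOn ℝ 1 γ (Icc (t i) (t (i + 1)))

namespace IsPiecewiseC1On

lemma of_contDiff (hγ : ContDiff ℝ 1 γ) (hab : a ≤ b) : IsPiecewiseC1On γ a b :=
  ⟨1, fun i => if i = 0 then a else b,
    monotone_nat_of_le_succ fun i => by by_cases hi : i = 0 <;> simp [hi, hab],
    by simp, by simp, fun _ _ => hγ.contDiffOn⟩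

lemma congr (h : IsPiecewiseC1On γ a b) {γ' : ℝ → F} (heq : EqOn γ' γ (Icc a b)) :
    IsPiecewiseC1On γ' a b := by
  obtain ⟨m, τ, hτ, h0, hm, hd⟩ := h
  refine ⟨m, τ, hτ, h0, hm, fun i hi => (hd i hi).congr fun t ht => heq ?_⟩
  rw [← h0, ← hm]
  exact Icc_subset_Icc (hτ i.zero_le) (hτ hi) ht

lemma trans (h₁ : IsPiecewiseC1On γ a b) (h₂ : IsPiecewiseC1On γ b c) :
    IsPiecewiseC1On γ a c := by
  obtain ⟨m₁, τ₁, hτ₁, ha, hb, hd₁⟩ := h₁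
  obtain ⟨m₂, τ₂, hτ₂, hb', hc, hd₂⟩ := h₂
  refine ⟨m₁ + m₂, fun i => τ₁ (min i m₁) + τ₂ (i - m₁) - b, fun i j hij => ?_, by simp [ha, hb'],
    by simp [hb, hc], fun i hi => ?_⟩
  · have h₁ := hτ₁ (min_le_min_right m₁ hij)
    have h₂ := hτ₂ (Nat.sub_le_sub_right hij m₁)
    simp only
    linarith
  rcases lt_or_ge i m₁ with him | him
  · simpa [min_eq_left him.le, min_eq_left (Nat.succ_le_of_lt him), Nat.sub_eq_zero_of_le him.le,
      Nat.sub_eq_zero_of_le (Nat.succ_le_of_lt him), hb'] using hd₁ i him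
  · simpa [min_eq_right him, min_eq_right (him.trans i.le_succ), Nat.sub_add_comm him, hb]
      using hd₂ (i - m₁) (by lia)

lemma comp_mul_add (h : IsPiecewiseC1On γ a b) (hc : 0 < c) (d : ℝ) :
    IsPiecewiseC1On (fun t => γ (c * t + d)) ((a - d) / c) ((b - d) / c) := by
  obtain ⟨m, τ, hτ, rfl, rfl, hd⟩ := h
  refine ⟨m, fun i => (τ i - d) / c, fun i j hij => by dsimp only; gcongr; exact hτ hij, rfl, rfl,
    fun i hi => (hd i hi).comp (by fun_prop) fun t ht => ?_⟩
  rw [mem_Icc, div_le_iff₀ hc, le_div_iff₀ hc] at ht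
  exact ⟨by linarith, by linarith⟩

lemma comp_const_sub (h : IsPiecewiseC1On γ a b) (d : ℝ) :
    IsPiecewiseC1On (fun t => γ (d - t)) (d - b) (d - a) := by
  obtain ⟨m, τ, hτ, h0, hm, hd⟩ := h
  refine ⟨m, fun i => d - τ (m - i), fun i j hij => sub_le_sub_left (hτ (by lia)) d,
    by simp [hm], by simp [h0], fun i hi => (hd (m - (i + 1)) (by lia)).comp (by fun_prop) ?_⟩
  intro t ht
  rw [show m - (i + 1) + 1 = m - i by lia]
  exact ⟨by linarith [ht.2], by linarith [ht.1]⟩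

lemma exists_countable_differentiableAt (h : IsPiecewiseC1On γ a b) :
    ∃ s : Set ℝ, s.Countable ∧ ∀ t ∈ Ioo a b \ s, DifferentiableAt ℝ γ t := by
  obtain ⟨m, τ, hτ, rfl, rfl, hd⟩ := h
  refine ⟨range τ, countable_range τ, fun t ht => ?_⟩
  have hmem : t ∈ ⋃ i ∈ Ico 0 m, Ioc (τ i) (τ (i + 1)) :=
    (hτ.biUnion_Ico_Ioc_map_succ 0 m).ge (Ioo_subset_Ioc_self ht.1)
  simp only [mem_iUnion] at hmem
  obtain ⟨i, hi, hlt, hle⟩ := hmem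
  have hlt' : t < τ (i + 1) := hle.lt_of_ne fun he => ht.2 ⟨i + 1, he.symm⟩
  exact ((hd i hi.2).differentiableOn one_ne_zero).differentiableAt (Icc_mem_nhds hlt hlt')

end IsPiecewiseC1On

end PiecewiseC1

section SupportingFunctional

variable {E : Type*} [NormedAddCommGroup E] [NormedSpace ℂ E] {D : Set E} {w z p q : E}
  {f : StrongDual ℂ E}

lemma exists_ne_zero_apply_eq_zero [FiniteDimensional ℂ E] (hE : 2 ≤ Module.finrank ℂ E)
    (f : StrongDual ℂ E) : ∃ u ≠ 0, f u = 0 := by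
  have hker : LinearMap.ker f.toLinearMap ≠ ⊥ :=
    LinearMap.ker_ne_bot_of_finrank_lt (by rw [Module.finrank_self]; lia)
  obtain ⟨u, hu, hu0⟩ := Submodule.exists_mem_ne_zero_of_ne_bot hker
  exact ⟨u, hu0, hu⟩

lemma eq_zero_of_apply_eq_zero [FiniteDimensional ℂ E] (hE : Module.finrank ℂ E ≤ 1)
    (hf : f ≠ 0) {u : E} (hu : f u = 0) : u = 0 := by
  obtain ⟨v, hv⟩ := finrank_le_one_iff.1 hE
  have hfv : f v ≠ 0 := fun h0 => hf <| ContinuousLinearMap.ext fun w => by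
    obtain ⟨c, rfl⟩ := hv w
    simp [h0]
  obtain ⟨c, rfl⟩ := hv u
  simp only [map_smul, smul_eq_mul, mul_eq_zero, hfv, or_false] at hu
  rw [hu, zero_smul]

/-- `f` is a norm-one complex functional with `D ⊆ {z | Re f(z) ≤ Re f(w)}`. For `w ∈ ∂D` the
complex supporting hyperplane of `D` at `w` that it defines is `{z | f (w - z) = 0}`. -/
structure IsSupportingFunctional (D : Set E) (w : E) (f : StrongDual ℂ E) : Prop where
  norm_eq_one : ‖f‖ = 1
  re_nonneg : ∀ z ∈ D, 0 ≤ (f (w - z)).re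

/-- No point of `closure D` lies on a complex supporting hyperplane of `D` at `p` and on one
at `q`. -/
def HasDisjointSupportingHyperplanes (D : Set E) (p q : E) : Prop :=
  ∀ f g, IsSupportingFunctional D p f → IsSupportingFunctional D q g →
    ∀ z ∈ closure D, f (p - z) = 0 → g (q - z) ≠ 0

lemma exists_isSupportingFunctional (hne : D.Nonempty) (hopen : IsOpen D) (hconv : Convex ℝ D)
    (hw : w ∉ D) : ∃ f, IsSupportingFunctional D w f := by
  obtain ⟨f, hf⟩ := RCLike.geometric_hahn_banach_open_point (𝕜 := ℂ) hconv hopen hw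
  have hf0 : f ≠ 0 := by
    obtain ⟨a, ha⟩ := hne
    rintro rfl
    simpa using hf a ha
  refine ⟨((‖f‖⁻¹ : ℝ) : ℂ) • f, ?_, fun z hz => ?_⟩
  · rw [norm_smul, Complex.norm_real, norm_inv, norm_norm,
      inv_mul_cancel₀ (norm_ne_zero_iff.2 hf0)]
  · rw [smul_apply, smul_eq_mul, Complex.re_ofReal_mul, map_sub, Complex.sub_re]
    exact mul_nonneg (by positivity) (sub_nonneg.2 (hf z hz).le)

namespace IsSupportingFunctional

lemma norm_apply_le (h : IsSupportingFunctional D w f) (v : E) : ‖f v‖ ≤ ‖v‖ := by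
  simpa only [h.norm_eq_one, one_mul] using f.le_opNorm v

lemma le_re_of_ball_subset (h : IsSupportingFunctional D w f) {r : ℝ} (hr : 0 < r)
    (hball : Metric.ball z r ⊆ D) : r ≤ (f (w - z)).re := by
  by_contra! hlt
  obtain ⟨v, hv, hfv⟩ := f.exists_lt_apply_of_lt_opNorm
    (h.norm_eq_one.symm ▸ (div_lt_one hr).2 hlt)
  obtain ⟨c, hc, hcv⟩ := Complex.exists_norm_mul_eq_self (f v)
  have hmem : z + ((r : ℂ) * c⁻¹) • v ∈ Metric.ball z r := by
    simpa [mem_ball_iff_norm, norm_smul, hc, abs_of_pos hr] using mul_lt_of_lt_one_right hr hv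
  have hval : f (w - (z + ((r : ℂ) * c⁻¹) • v)) = f (w - z) - ((r * ‖f v‖ : ℝ) : ℂ) := by
    have hc0 : c ≠ 0 := norm_ne_zero_iff.1 (hc ▸ one_ne_zero)
    rw [← sub_sub, map_sub, map_smul, smul_eq_mul, mul_assoc, ← hcv, inv_mul_cancel_left₀ hc0]
    simp [hc]
  have hnonneg := h.re_nonneg _ (hball hmem)
  rw [hval, Complex.sub_re, Complex.ofReal_re] at hnonneg
  rw [div_lt_iff₀' hr] at hfv
  linarith

lemma re_pos (h : IsSupportingFunctional D w f) (hopen : IsOpen D) (hz : z ∈ D) :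
    0 < (f (w - z)).re := by
  obtain ⟨r, hr, hball⟩ := Metric.isOpen_iff.1 hopen z hz
  exact hr.trans_le (h.le_re_of_ball_subset hr hball)

lemma notMem_of_apply_eq_zero (h : IsSupportingFunctional D w f) (hopen : IsOpen D)
    (hz : f (w - z) = 0) : z ∉ D := fun hzD => by
  simpa [hz] using h.re_pos hopen hzD

end IsSupportingFunctional

lemma isClosed_setOf_isSupportingFunctional (D : Set E) :
    IsClosed {x : E × StrongDual ℂ E | IsSupportingFunctional D x.1 x.2} := by
  have heq : {x : E × StrongDual ℂ E | IsSupportingFunctional D x.1 x.2} =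
      {x | ‖x.2‖ = 1} ∩ ⋂ z ∈ D, {x | 0 ≤ (x.2 (x.1 - z)).re} := by
    ext x
    simp only [mem_ofPred_eq, mem_inter_iff, mem_iInter]
    exact ⟨fun h => ⟨h.1, h.2⟩, fun h => ⟨h.1, h.2⟩⟩
  rw [heq]
  exact (isClosed_eq (by fun_prop) continuous_const).inter <| isClosed_biInter fun z _ =>
    isClosed_le continuous_const (by fun_prop)

lemma isCompact_setOf_isSupportingFunctional [FiniteDimensional ℂ E] (D : Set E) {K : Set E}
    (hK : IsCompact K) :
    IsCompact {x : E × StrongDual ℂ E | x.1 ∈ K ∧ IsSupportingFunctional D x.1 x.2} := by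
  have := FiniteDimensional.proper ℂ (StrongDual ℂ E)
  refine ((hK.prod (isCompact_closedBall (0 : StrongDual ℂ E) 1)).inter_right
    (isClosed_setOf_isSupportingFunctional D)).of_isClosed_subset
    ((hK.isClosed.preimage continuous_fst).inter (isClosed_setOf_isSupportingFunctional D))
    fun x hx => ⟨⟨hx.1, ?_⟩, hx.2⟩
  rw [mem_closedBall_zero_iff, hx.2.norm_eq_one]

lemma HasDisjointSupportingHyperplanes.exists_pos_le_norm_or [FiniteDimensional ℂ E]
    (hbdd : Bornology.IsBounded D) (hpq : HasDisjointSupportingHyperplanes D p q) :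
    ∃ c > 0, ∀ w w' f g, IsSupportingFunctional D w f → IsSupportingFunctional D w' g →
      dist w p < c → dist w' q < c → ∀ z ∈ D, c ≤ ‖f (w - z)‖ ∨ c ≤ ‖g (w' - z)‖ := by
  have := FiniteDimensional.proper ℂ E
  let K (a : E) : Set (E × StrongDual ℂ E) :=
    {x | x.1 ∈ Metric.closedBall a 1 ∧ IsSupportingFunctional D x.1 x.2}
  have hK : IsCompact ((K p ×ˢ K q) ×ˢ closure D) :=
    ((isCompact_setOf_isSupportingFunctional D (isCompact_closedBall p 1)).prod
      (isCompact_setOf_isSupportingFunctional D (isCompact_closedBall q 1))).prod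
      hbdd.isCompact_closure
  let F (x : ((E × StrongDual ℂ E) × E × StrongDual ℂ E) × E) : ℝ :=
    max (max (dist x.1.1.1 p) (dist x.1.2.1 q))
      (max ‖x.1.1.2 (x.1.1.1 - x.2)‖ ‖x.1.2.2 (x.1.2.1 - x.2)‖)
  have hF : Continuous F := by fun_prop
  obtain ⟨c, hc, hcF⟩ := hK.exists_forall_le' hF.continuousOn (a := 0) <| by
    rintro ⟨⟨⟨w, f⟩, w', g⟩, z⟩ ⟨⟨⟨-, hf⟩, -, hg⟩, hz⟩
    by_contra! hle
    simp only [F, max_le_iff, dist_le_zero, norm_le_zero_iff] at hle hf hg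
    obtain ⟨⟨rfl, rfl⟩, hfz, hgz⟩ := hle
    exact hpq f g hf hg z hz hfz hgz
  refine ⟨min c 1, lt_min hc one_pos, fun w w' f g hf hg hw hw' z hz => ?_⟩
  rw [lt_min_iff] at hw hw'
  have hmax := hcF ((((w, f), (w', g)), z)) ⟨⟨⟨hw.2.le, hf⟩, hw'.2.le, hg⟩, subset_closure hz⟩
  simp only [F, le_max_iff, hw.1.not_ge, hw'.1.not_ge, false_or] at hmax
  exact hmax.imp (min_le_left c 1).trans (min_le_left c 1).trans

end SupportingFunctional

section KobayashiMetric

lemma le_mul_sInf {b c : ENNReal} {S : Set ENNReal} (hc₀ : c ≠ 0) (hc : c ≠ ⊤)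
    (h : ∀ r ∈ S, b ≤ c * r) : b ≤ c * sInf S := by
  rw [sInf_eq_iInf', ENNReal.mul_iInf_of_ne hc₀ hc]
  exact le_iInf fun r => h r r.2

variable {n : ℕ} {D : Set (EuclideanSpace ℂ (Fin n))} {z : EuclideanSpace ℂ (Fin n)}

lemma kobayashiMetric_le_enorm {φ : ℂ → EuclideanSpace ℂ (Fin n)}
    (hφ : DifferentiableOn ℂ φ (Metric.ball 0 1)) (hmaps : MapsTo φ (Metric.ball 0 1) D) (α : ℂ) :
    kobayashiMetric D (φ 0) (α • deriv φ 0) ≤ ‖α‖ₑ :=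
  sInf_le ⟨α, φ, hφ, hmaps, rfl, rfl, rfl⟩

lemma kobayashiMetric_le_of_ball_subset {r : ℝ} (hr : 0 < r) (hball : Metric.ball z r ⊆ D)
    (X : EuclideanSpace ℂ (Fin n)) : kobayashiMetric D z X ≤ ENNReal.ofReal (‖X‖ / r) := by
  obtain ⟨u, hu, hXu⟩ : ∃ u : EuclideanSpace ℂ (Fin n), ‖u‖ ≤ 1 ∧ (‖X‖ : ℂ) • u = X := by
    rcases eq_or_ne X 0 with rfl | hX
    · exact ⟨0, by simp⟩
    · exact ⟨((‖X‖⁻¹ : ℝ) : ℂ) • X, by simp [norm_smul, norm_ne_zero_iff.2 hX],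
        by simp [smul_smul, norm_ne_zero_iff.2 hX]⟩
  let φ (ζ : ℂ) : EuclideanSpace ℂ (Fin n) := z + ζ • (r : ℂ) • u
  have hφ : HasDerivAt φ ((r : ℂ) • u) 0 := by
    simpa [φ] using (hasDerivAt_id (0 : ℂ)).smul_const ((r : ℂ) • u)
  have hmaps : MapsTo φ (Metric.ball 0 1) D := fun ζ hζ => hball <| by
    rw [mem_ball_zero_iff] at hζ
    rw [mem_ball_iff_norm, add_sub_cancel_left, norm_smul, norm_smul, Complex.norm_real,
      Real.norm_of_nonneg hr.le]
    calc ‖ζ‖ * (r * ‖u‖)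
      _ ≤ ‖ζ‖ * r := by gcongr; exact mul_le_of_le_one_right hr.le hu
      _ < r := mul_lt_of_lt_one_left hr hζ
  have hX : ((‖X‖ / r : ℝ) : ℂ) • deriv φ 0 = X := by
    rw [hφ.deriv, smul_smul, ← Complex.ofReal_mul, div_mul_cancel₀ _ hr.ne', hXu]
  have hle := kobayashiMetric_le_enorm (by fun_prop) hmaps ((‖X‖ / r : ℝ) : ℂ)
  rwa [hX, ← ofReal_norm, Complex.norm_real, Real.norm_of_nonneg (by positivity),
    show φ 0 = z by simp [φ]] at hle

lemma kobayashiMetric_smul_le (D : Set (EuclideanSpace ℂ (Fin n)))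
    (z X : EuclideanSpace ℂ (Fin n)) {c : ℂ} (hc : c ≠ 0) :
    kobayashiMetric D z (c • X) ≤ ‖c‖ₑ * kobayashiMetric D z X := by
  refine le_mul_sInf (enorm_ne_zero.2 hc) enorm_ne_top ?_
  rintro _ ⟨α, φ, hφ, hmaps, rfl, rfl, rfl⟩
  rw [smul_smul, ← enorm_mul]
  exact kobayashiMetric_le_enorm hφ hmaps (c * α)

lemma kobayashiMetric_smul (D : Set (EuclideanSpace ℂ (Fin n)))
    (z X : EuclideanSpace ℂ (Fin n)) {c : ℂ} (hc : c ≠ 0) :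
    kobayashiMetric D z (c • X) = ‖c‖ₑ * kobayashiMetric D z X := by
  refine (kobayashiMetric_smul_le D z X hc).antisymm ?_
  have hle := kobayashiMetric_smul_le D z (c • X) (inv_ne_zero hc)
  rw [inv_smul_smul₀ hc] at hle
  calc ‖c‖ₑ * kobayashiMetric D z X
    _ ≤ ‖c‖ₑ * (‖c⁻¹‖ₑ * kobayashiMetric D z (c • X)) := by gcongr
    _ = kobayashiMetric D z (c • X) := by
      rw [← mul_assoc, ← enorm_mul, mul_inv_cancel₀ hc, enorm_one, one_mul]

variable {F : Type*} [NormedAddCommGroup F] [NormedSpace ℂ F]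

lemma enorm_fderiv_le_mul_kobayashiMetric {G : EuclideanSpace ℂ (Fin n) → F}
    (hG : DifferentiableAt ℂ G z) {C : ℝ} (hC : 0 < C)
    (hdisc : ∀ φ : ℂ → EuclideanSpace ℂ (Fin n), DifferentiableOn ℂ φ (Metric.ball 0 1) →
      MapsTo φ (Metric.ball 0 1) D → φ 0 = z → ‖deriv (fun ζ => G (φ ζ)) 0‖ ≤ C)
    (X : EuclideanSpace ℂ (Fin n)) :
    ‖fderiv ℂ G z X‖ₑ ≤ ENNReal.ofReal C * kobayashiMetric D z X := by
  refine le_mul_sInf (ENNReal.ofReal_pos.2 hC).ne' ENNReal.ofReal_ne_top ?_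
  rintro _ ⟨α, φ, hφ, hmaps, rfl, rfl, rfl⟩
  have hφ₀ : DifferentiableAt ℂ φ 0 := hφ.differentiableAt (Metric.ball_mem_nhds 0 one_pos)
  have hderiv : deriv (fun ζ => G (φ ζ)) 0 = fderiv ℂ G (φ 0) (deriv φ 0) :=
    (hG.hasFDerivAt.comp_hasDerivAt (0 : ℂ) hφ₀.hasDerivAt).deriv
  have hle := hdisc φ hφ hmaps rfl
  rw [hderiv] at hle
  rw [map_smul, enorm_smul, mul_comm, ← ofReal_norm (fderiv ℂ G (φ 0) (deriv φ 0))]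
  gcongr

lemma enorm_le_mul_kobayashiMetric {R : ℝ} (hR : 0 < R) (hD : ∀ x ∈ D, ∀ y ∈ D, dist x y ≤ R)
    (z X : EuclideanSpace ℂ (Fin n)) : ‖X‖ₑ ≤ ENNReal.ofReal R * kobayashiMetric D z X := by
  refine (congrArg enorm (by simp)).trans_le <|
    enorm_fderiv_le_mul_kobayashiMetric (G := id) differentiableAt_id hR
      (fun φ hφ hmaps _ => ?_) X
  simpa only [id, div_one] using Complex.norm_deriv_le_div_of_mapsTo_ball hφ
    (fun ζ hζ => hD _ (hmaps hζ) _ (hmaps (Metric.mem_ball_self one_pos))) one_pos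

lemma enorm_fderiv_log_le_kobayashiMetric {g : EuclideanSpace ℂ (Fin n) → ℂ} (hopen : IsOpen D)
    (hg : DifferentiableOn ℂ g D) (hpos : ∀ z ∈ D, 0 < (g z).re) (hz : z ∈ D)
    (X : EuclideanSpace ℂ (Fin n)) :
    ‖fderiv ℂ (fun z => Complex.log (g z)) z X‖ₑ ≤
      ENNReal.ofReal 2 * kobayashiMetric D z X := by
  refine enorm_fderiv_le_mul_kobayashiMetric
    ((hg.differentiableAt (hopen.mem_nhds hz)).clog (Or.inl (hpos z hz))) two_pos
    (fun φ hφ hmaps _ => ?_) X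
  have hball : (0 : ℂ) ∈ Metric.ball (0 : ℂ) 1 := Metric.mem_ball_self one_pos
  have hgφ : DifferentiableOn ℂ (fun ζ => g (φ ζ)) (Metric.ball 0 1) := hg.comp hφ hmaps
  have hderiv : deriv (fun ζ => Complex.log (g (φ ζ))) 0 =
      deriv (fun ζ => g (φ ζ)) 0 / g (φ 0) :=
    ((hgφ.differentiableAt (Metric.isOpen_ball.mem_nhds hball)).hasDerivAt.clog
      (Or.inl (hpos _ (hmaps hball)))).deriv
  have hre : 0 < (g (φ 0)).re := hpos _ (hmaps hball)
  have hschwarz := norm_deriv_zero_le_of_re_pos one_pos hgφ fun ζ hζ => hpos _ (hmaps hζ)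
  rw [hderiv, norm_div, div_le_iff₀ (hre.trans_le (Complex.re_le_norm _))]
  linarith [Complex.re_le_norm (g (φ 0))]

end KobayashiMetric

section Length

variable {n : ℕ} {D : Set (EuclideanSpace ℂ (Fin n))} {x y z : EuclideanSpace ℂ (Fin n)}
  {γ γ₁ γ₂ : ℝ → EuclideanSpace ℂ (Fin n)} {a b c : ℝ}

/-- The Kobayashi length of the part of the curve `γ` over the set `s` of parameters. -/
noncomputable def kobayashiLength (D : Set (EuclideanSpace ℂ (Fin n)))
    (γ : ℝ → EuclideanSpace ℂ (Fin n)) (s : Set ℝ) : ENNReal :=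
  ∫⁻ t in s, kobayashiMetric D (γ t) (deriv γ t)

lemma kobayashiLength_Icc_add_Icc (D : Set (EuclideanSpace ℂ (Fin n)))
    (γ : ℝ → EuclideanSpace ℂ (Fin n)) (hab : a ≤ b) (hbc : b ≤ c) :
    kobayashiLength D γ (Icc a b) + kobayashiLength D γ (Icc b c) =
      kobayashiLength D γ (Icc a c) := by
  have hdisj : Disjoint (Icc a b) (Ioc b c) :=
    Set.disjoint_left.2 fun t ht ht' => ht.2.not_gt ht'.1
  rw [kobayashiLength, kobayashiLength, kobayashiLength, ← Icc_union_Ioc_eq_Icc hab hbc,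
    lintegral_union measurableSet_Ioc hdisj, setLIntegral_congr Ioc_ae_eq_Icc]

lemma kobayashiLength_congr (h : EqOn γ₁ γ₂ (Icc a b)) :
    kobayashiLength D γ₁ (Icc a b) = kobayashiLength D γ₂ (Icc a b) := by
  rw [kobayashiLength, kobayashiLength, setLIntegral_congr Ioo_ae_eq_Icc.symm,
    setLIntegral_congr Ioo_ae_eq_Icc.symm]
  refine setLIntegral_congr_fun measurableSet_Ioo fun t ht => ?_
  have hderiv := (h.eventuallyEq_of_mem (Icc_mem_nhds ht.1 ht.2)).deriv_eq
  rw [h (Ioo_subset_Icc_self ht), hderiv]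

lemma kobayashiLength_comp_mul_add (D : Set (EuclideanSpace ℂ (Fin n)))
    (γ : ℝ → EuclideanSpace ℂ (Fin n)) (hc : c ≠ 0) (d : ℝ) {s : Set ℝ} (hs : MeasurableSet s) :
    kobayashiLength D (fun t => γ (c * t + d)) s =
      kobayashiLength D γ ((fun t => c * t + d) '' s) := by
  have hderiv (t : ℝ) : HasDerivWithinAt (fun t => c * t + d) c s t := by
    simpa using (((hasDerivAt_id t).const_mul c).add_const d).hasDerivWithinAt
  have hinj : InjOn (fun t => c * t + d) s := fun t _ t' _ h => by simpa [hc] using h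
  rw [kobayashiLength, kobayashiLength,
    lintegral_image_eq_lintegral_abs_deriv_mul hs (fun t _ => hderiv t) hinj]
  refine lintegral_congr fun t => ?_
  rw [deriv_comp_mul_left c (fun t => γ (t + d)), deriv_comp_add_const, ← Complex.coe_smul,
    kobayashiMetric_smul _ _ _ (Complex.ofReal_ne_zero.2 hc), ← ofReal_norm, Complex.norm_real,
    Real.norm_eq_abs]

lemma IsPiecewiseC1Curve.kobayashiEDist_le (h : IsPiecewiseC1Curve D x y γ) :
    kobayashiEDist D x y ≤ kobayashiLength D γ (Icc 0 1) :=
  sInf_le ⟨γ, h, rfl⟩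

lemma le_mul_kobayashiEDist {r C : ENNReal} (hC₀ : C ≠ 0) (hC : C ≠ ⊤)
    (h : ∀ γ, IsPiecewiseC1Curve D x y γ → r ≤ C * kobayashiLength D γ (Icc 0 1)) :
    r ≤ C * kobayashiEDist D x y :=
  le_mul_sInf hC₀ hC <| by
    rintro _ ⟨γ, hγ, rfl⟩
    exact h γ hγ

lemma le_kobayashiEDist {r : ENNReal}
    (h : ∀ γ, IsPiecewiseC1Curve D x y γ → r ≤ kobayashiLength D γ (Icc 0 1)) :
    r ≤ kobayashiEDist D x y :=
  le_sInf <| by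
    rintro _ ⟨γ, hγ, rfl⟩
    exact h γ hγ

lemma IsPiecewiseC1Curve.reverse (h : IsPiecewiseC1Curve D x y γ) :
    IsPiecewiseC1Curve D y x fun t => γ (1 - t) where
  mapsTo t ht := h.mapsTo ⟨by linarith [ht.2], by linarith [ht.1]⟩
  source := by rw [sub_zero, h.target]
  target := by rw [sub_self, h.source]
  continuousOn := h.continuousOn.comp (by fun_prop)
    fun t ht => ⟨by linarith [ht.2], by linarith [ht.1]⟩
  piecewise := by
    simpa only [sub_self, sub_zero] using! IsPiecewiseC1On.comp_const_sub h.piecewise 1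

lemma kobayashiLength_reverse (D : Set (EuclideanSpace ℂ (Fin n)))
    (γ : ℝ → EuclideanSpace ℂ (Fin n)) :
    kobayashiLength D (fun t => γ (1 - t)) (Icc 0 1) = kobayashiLength D γ (Icc 0 1) := by
  have hrev : (fun t => γ (1 - t)) = fun t => γ (-1 * t + 1) := by ext1 t; ring_nf
  rw [hrev, kobayashiLength_comp_mul_add D γ (by norm_num) 1 measurableSet_Icc]
  congr 1
  simp [← sub_eq_neg_add]

lemma kobayashiEDist_comm (D : Set (EuclideanSpace ℂ (Fin n)))
    (x y : EuclideanSpace ℂ (Fin n)) : kobayashiEDist D x y = kobayashiEDist D y x := by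
  have hle (x y) : kobayashiEDist D x y ≤ kobayashiEDist D y x := le_kobayashiEDist fun γ hγ =>
    hγ.reverse.kobayashiEDist_le.trans_eq (kobayashiLength_reverse D γ)
  exact (hle x y).antisymm (hle y x)

/-- The curve that runs through `γ₁` and then through `γ₂`, each at double speed. -/
noncomputable def concat (γ₁ γ₂ : ℝ → EuclideanSpace ℂ (Fin n)) (t : ℝ) :
    EuclideanSpace ℂ (Fin n) :=
  if t ≤ 1 / 2 then γ₁ (2 * t + 0) else γ₂ (2 * t + -1)

lemma concat_eqOn_left (γ₁ γ₂ : ℝ → EuclideanSpace ℂ (Fin n)) :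
    EqOn (concat γ₁ γ₂) (fun t => γ₁ (2 * t + 0)) (Icc 0 (1 / 2)) :=
  fun _ ht => if_pos ht.2

lemma concat_eqOn_right (h : γ₁ 1 = γ₂ 0) :
    EqOn (concat γ₁ γ₂) (fun t => γ₂ (2 * t + -1)) (Icc (1 / 2) 1) := by
  intro t ht
  rcases ht.1.eq_or_lt with rfl | hlt
  · norm_num [concat, h]
  · exact if_neg hlt.not_ge

lemma IsPiecewiseC1Curve.concat (h₁ : IsPiecewiseC1Curve D x y γ₁)
    (h₂ : IsPiecewiseC1Curve D y z γ₂) : IsPiecewiseC1Curve D x z (concat γ₁ γ₂) := by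
  have hleft := concat_eqOn_left γ₁ γ₂
  have hright := concat_eqOn_right (h₁.target.trans h₂.source.symm)
  have hmaps₁ : MapsTo (fun t : ℝ => 2 * t + 0) (Icc 0 (1 / 2)) (Icc 0 1) :=
    fun t ht => ⟨by linarith [ht.1], by linarith [ht.2]⟩
  have hmaps₂ : MapsTo (fun t : ℝ => 2 * t + -1) (Icc (1 / 2) 1) (Icc 0 1) :=
    fun t ht => ⟨by linarith [ht.1], by linarith [ht.2]⟩
  have hunion : Icc (0 : ℝ) (1 / 2) ∪ Icc (1 / 2) 1 = Icc 0 1 :=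
    Icc_union_Icc_eq_Icc (by norm_num) (by norm_num)
  have hC1 : IsPiecewiseC1On (ConvexVisibility.concat γ₁ γ₂) 0 1 := by
    refine IsPiecewiseC1On.trans (b := 1 / 2) (.congr ?_ hleft) (.congr ?_ hright)
    · simpa using IsPiecewiseC1On.comp_mul_add h₁.piecewise two_pos 0
    · convert IsPiecewiseC1On.comp_mul_add h₂.piecewise two_pos (-1) using 1 <;> norm_num
  refine ⟨?_, ?_, ?_, ?_, hC1⟩
  · rw [← hunion]
    exact ((h₁.mapsTo.comp hmaps₁).congr hleft.symm).union
      ((h₂.mapsTo.comp hmaps₂).congr hright.symm)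
  · norm_num [ConvexVisibility.concat, h₁.source]
  · norm_num [ConvexVisibility.concat, h₂.target]
  · rw [← hunion]
    exact ((h₁.continuousOn.comp (by fun_prop) hmaps₁).congr hleft).union_of_isClosed
      ((h₂.continuousOn.comp (by fun_prop) hmaps₂).congr hright) isClosed_Icc isClosed_Icc

lemma kobayashiLength_concat (D : Set (EuclideanSpace ℂ (Fin n))) (h : γ₁ 1 = γ₂ 0) :
    kobayashiLength D (concat γ₁ γ₂) (Icc 0 1) =
      kobayashiLength D γ₁ (Icc 0 1) + kobayashiLength D γ₂ (Icc 0 1) := by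
  rw [← kobayashiLength_Icc_add_Icc D _ (b := 1 / 2) (by norm_num) (by norm_num),
    kobayashiLength_congr (concat_eqOn_left γ₁ γ₂), kobayashiLength_congr (concat_eqOn_right h),
    kobayashiLength_comp_mul_add D γ₁ two_ne_zero 0 measurableSet_Icc,
    kobayashiLength_comp_mul_add D γ₂ two_ne_zero (-1) measurableSet_Icc,
    image_affine_Icc' two_pos, image_affine_Icc' two_pos]
  norm_num

lemma kobayashiEDist_triangle (D : Set (EuclideanSpace ℂ (Fin n)))
    (x y z : EuclideanSpace ℂ (Fin n)) :
    kobayashiEDist D x z ≤ kobayashiEDist D x y + kobayashiEDist D y z := by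
  rw [kobayashiEDist.eq_def D x y, ENNReal.sInf_add]
  refine le_iInf₂ ?_
  rintro _ ⟨γ₁, h₁, rfl⟩
  rw [kobayashiEDist.eq_def D y z, ENNReal.add_sInf]
  refine le_iInf₂ ?_
  rintro _ ⟨γ₂, h₂, rfl⟩
  exact (h₁.concat h₂).kobayashiEDist_le.trans
    (kobayashiLength_concat D (h₁.target.trans h₂.source.symm)).le

variable {F : Type*} [NormedAddCommGroup F] [NormedSpace ℂ F] [CompleteSpace F]

lemma IsPiecewiseC1Curve.enorm_comp_sub_le (h : IsPiecewiseC1Curve D x y γ) (hopen : IsOpen D)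
    {G : EuclideanSpace ℂ (Fin n) → F} (hG : DifferentiableOn ℂ G D) {C : ℝ}
    (hle : ∀ z ∈ D, ∀ X, ‖fderiv ℂ G z X‖ₑ ≤ ENNReal.ofReal C * kobayashiMetric D z X)
    (ha : 0 ≤ a) (hab : a ≤ b) (hb : b ≤ 1) :
    ‖G (γ b) - G (γ a)‖ₑ ≤ ENNReal.ofReal C * kobayashiLength D γ (Icc a b) := by
  obtain ⟨s, hs, hd⟩ := IsPiecewiseC1On.exists_countable_differentiableAt h.piecewise
  have hmaps : MapsTo γ (Icc a b) D := h.mapsTo.mono_left (Icc_subset_Icc ha hb)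
  have hderiv : ∀ t ∈ Ioo a b \ s,
      HasDerivAt (fun t => G (γ t)) (fderiv ℂ G (γ t) (deriv γ t)) t := fun t ht => by
    have hGt := hG.differentiableAt (hopen.mem_nhds (hmaps (Ioo_subset_Icc_self ht.1)))
    exact (hGt.hasFDerivAt.restrictScalars ℝ).comp_hasDerivAt t
      (hd t ⟨Ioo_subset_Ioo ha hb ht.1, ht.2⟩).hasDerivAt
  have hcont : ContinuousOn (fun t => G (γ t)) (Icc a b) :=
    hG.continuousOn.comp (h.continuousOn.mono (Icc_subset_Icc ha hb)) hmaps
  refine (enorm_sub_le_lintegral_deriv_of_countable hab hs hcont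
    fun t ht => (hderiv t ht).differentiableAt).trans ?_
  rw [kobayashiLength, ← lintegral_const_mul' _ _ ENNReal.ofReal_ne_top,
    setLIntegral_congr Ioo_ae_eq_Icc.symm, setLIntegral_congr Ioo_ae_eq_Icc.symm]
  refine lintegral_mono_ae ?_
  filter_upwards [ae_restrict_of_ae (hs.ae_notMem volume), ae_restrict_mem measurableSet_Ioo]
    with t hts ht
  rw [(hderiv t ⟨ht, hts⟩).deriv]
  exact hle _ (hmaps (Ioo_subset_Icc_self ht)) _

end Length

section HalfPlane

variable {n : ℕ} {D : Set (EuclideanSpace ℂ (Fin n))} {x y : EuclideanSpace ℂ (Fin n)}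
  {γ : ℝ → EuclideanSpace ℂ (Fin n)} {a b : ℝ} {g g₁ g₂ : EuclideanSpace ℂ (Fin n) → ℂ}

lemma IsPiecewiseC1Curve.half_abs_log_sub_le (h : IsPiecewiseC1Curve D x y γ) (hopen : IsOpen D)
    (hg : DifferentiableOn ℂ g D) (hpos : ∀ z ∈ D, 0 < (g z).re) (ha : 0 ≤ a) (hab : a ≤ b)
    (hb : b ≤ 1) : ENNReal.ofReal (1 / 2 * |Real.log ‖g (γ b)‖ - Real.log ‖g (γ a)‖|) ≤
      kobayashiLength D γ (Icc a b) := by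
  have hle := h.enorm_comp_sub_le hopen (hg.clog fun z hz => Or.inl (hpos z hz))
    (fun z hz X => enorm_fderiv_log_le_kobayashiMetric hopen hg hpos hz X) ha hab hb
  have habs : |Real.log ‖g (γ b)‖ - Real.log ‖g (γ a)‖| ≤
      ‖Complex.log (g (γ b)) - Complex.log (g (γ a))‖ := by
    simpa only [Complex.sub_re, Complex.log_re] using Complex.abs_re_le_norm
      (Complex.log (g (γ b)) - Complex.log (g (γ a)))
  calc ENNReal.ofReal (1 / 2 * |Real.log ‖g (γ b)‖ - Real.log ‖g (γ a)‖|)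
    _ ≤ ENNReal.ofReal (1 / 2) * ‖Complex.log (g (γ b)) - Complex.log (g (γ a))‖ₑ := by
      rw [ENNReal.ofReal_mul (by norm_num), ← ofReal_norm]
      gcongr
    _ ≤ ENNReal.ofReal (1 / 2) * (ENNReal.ofReal 2 * kobayashiLength D γ (Icc a b)) := by gcongr
    _ = kobayashiLength D γ (Icc a b) := by
      rw [← mul_assoc, ← ENNReal.ofReal_mul (by norm_num)]
      norm_num

lemma half_abs_log_sub_le_kobayashiEDist (hopen : IsOpen D) (hg : DifferentiableOn ℂ g D)
    (hpos : ∀ z ∈ D, 0 < (g z).re) (x y : EuclideanSpace ℂ (Fin n)) :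
    ENNReal.ofReal (1 / 2 * |Real.log ‖g y‖ - Real.log ‖g x‖|) ≤ kobayashiEDist D x y :=
  le_kobayashiEDist fun γ hγ => by
    simpa only [hγ.source, hγ.target] using
      hγ.half_abs_log_sub_le hopen hg hpos le_rfl zero_le_one le_rfl

lemma exists_le_and_le_of_forall_le_or {X α : Type*} [TopologicalSpace X] [LinearOrder α]
    [TopologicalSpace α] [OrderClosedTopology α] {s : Set X} (hs : IsPreconnected s) {a b : X}
    (ha : a ∈ s) (hb : b ∈ s) {f₁ f₂ : X → α} (hf₁ : ContinuousOn f₁ s) (hf₂ : ContinuousOn f₂ s)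
    {c : α} (hor : ∀ t ∈ s, c ≤ f₁ t ∨ c ≤ f₂ t) (hac : f₁ a < c) (hbc : f₂ b < c) :
    ∃ t ∈ s, c ≤ f₁ t ∧ c ≤ f₂ t := by
  obtain ⟨t, ht, heq⟩ := hs.intermediate_value₂ ha hb hf₁ hf₂
    (hac.le.trans ((hor a ha).resolve_left hac.not_ge))
    (hbc.le.trans ((hor b hb).resolve_right hbc.not_ge))
  have hct : c ≤ f₁ t := (hor t ht).elim id heq.ge.trans'
  exact ⟨t, ht, hct, heq ▸ hct⟩

lemma half_log_sub_add_half_log_sub_le_kobayashiEDist (hopen : IsOpen D)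
    (hg₁ : DifferentiableOn ℂ g₁ D) (hpos₁ : ∀ z ∈ D, 0 < (g₁ z).re)
    (hg₂ : DifferentiableOn ℂ g₂ D) (hpos₂ : ∀ z ∈ D, 0 < (g₂ z).re) {c : ℝ} (hc : 0 < c)
    (hor : ∀ z ∈ D, c ≤ ‖g₁ z‖ ∨ c ≤ ‖g₂ z‖) (hx : ‖g₁ x‖ < c) (hy : ‖g₂ y‖ < c) :
    ENNReal.ofReal (1 / 2 * (Real.log c - Real.log ‖g₁ x‖) +
      1 / 2 * (Real.log c - Real.log ‖g₂ y‖)) ≤ kobayashiEDist D x y := by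
  refine le_kobayashiEDist fun γ hγ => ?_
  obtain ⟨t, ht, hct₁, hct₂⟩ := exists_le_and_le_of_forall_le_or (isPreconnected_Icc (a := 0))
    (left_mem_Icc.2 zero_le_one) (right_mem_Icc.2 zero_le_one)
    (hg₁.continuousOn.comp hγ.continuousOn hγ.mapsTo).norm
    (hg₂.continuousOn.comp hγ.continuousOn hγ.mapsTo).norm (fun t ht => hor _ (hγ.mapsTo ht))
    (by simpa only [Function.comp_apply, hγ.source])
    (by simpa only [Function.comp_apply, hγ.target])
  have hlen₁ := hγ.half_abs_log_sub_le hopen hg₁ hpos₁ le_rfl ht.1 ht.2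
  have hlen₂ := hγ.half_abs_log_sub_le hopen hg₂ hpos₂ ht.1 ht.2 le_rfl
  rw [hγ.source] at hlen₁
  rw [hγ.target, abs_sub_comm] at hlen₂
  have hlog₁ : Real.log c - Real.log ‖g₁ x‖ ≤ |Real.log ‖g₁ (γ t)‖ - Real.log ‖g₁ x‖| :=
    (sub_le_sub_right (Real.log_le_log hc hct₁) _).trans (le_abs_self _)
  have hlog₂ : Real.log c - Real.log ‖g₂ y‖ ≤ |Real.log ‖g₂ (γ t)‖ - Real.log ‖g₂ y‖| :=
    (sub_le_sub_right (Real.log_le_log hc hct₂) _).trans (le_abs_self _)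
  rw [← kobayashiLength_Icc_add_Icc D γ ht.1 ht.2]
  exact ENNReal.ofReal_add_le.trans <| add_le_add
    ((ENNReal.ofReal_le_ofReal (by gcongr)).trans hlen₁)
    ((ENNReal.ofReal_le_ofReal (by gcongr)).trans hlen₂)

end HalfPlane

section KobayashiDist

variable {n : ℕ} {D : Set (EuclideanSpace ℂ (Fin n))} {x y z : EuclideanSpace ℂ (Fin n)}

lemma isPiecewiseC1Curve_lineMap (hconv : Convex ℝ D) (hx : x ∈ D) (hy : y ∈ D) :
    IsPiecewiseC1Curve D x y (AffineMap.lineMap (k := ℝ) x y) where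
  mapsTo _ ht := hconv.lineMap_mem hx hy ht
  source := AffineMap.lineMap_apply_zero x y
  target := AffineMap.lineMap_apply_one x y
  continuousOn := AffineMap.lineMap_continuous.continuousOn
  piecewise := IsPiecewiseC1On.of_contDiff (AffineMap.contDiff_lineMap x y) zero_le_one

lemma kobayashiEDist_le_of_ball_subset (hconv : Convex ℝ D) {r : ℝ} (hr : 0 < r)
    (hx : Metric.ball x r ⊆ D) (hy : Metric.ball y r ⊆ D) :
    kobayashiEDist D x y ≤ ENNReal.ofReal (dist x y / r) := by
  have hball (t : ℝ) (ht : t ∈ Icc 0 1) : Metric.ball (AffineMap.lineMap x y t) r ⊆ D :=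
    (convex_setOf_ball_subset hconv r).lineMap_mem hx hy ht
  refine (isPiecewiseC1Curve_lineMap hconv (hx (Metric.mem_ball_self hr))
    (hy (Metric.mem_ball_self hr))).kobayashiEDist_le.trans ?_
  calc kobayashiLength D (AffineMap.lineMap x y) (Icc 0 1)
    _ ≤ ∫⁻ _ in Icc (0 : ℝ) 1, ENNReal.ofReal (dist x y / r) := by
      refine setLIntegral_mono measurable_const fun t ht => ?_
      rw [AffineMap.hasDerivAt_lineMap.deriv, dist_comm, dist_eq_norm]
      exact kobayashiMetric_le_of_ball_subset hr (hball t ht) _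
    _ = ENNReal.ofReal (dist x y / r) := by simp

lemma kobayashiEDist_ne_top (hopen : IsOpen D) (hconv : Convex ℝ D) (hx : x ∈ D) (hy : y ∈ D) :
    kobayashiEDist D x y ≠ ⊤ := by
  obtain ⟨r, hr, hxr⟩ := Metric.isOpen_iff.1 hopen x hx
  obtain ⟨s, hs, hys⟩ := Metric.isOpen_iff.1 hopen y hy
  exact ne_top_of_le_ne_top ENNReal.ofReal_ne_top <| kobayashiEDist_le_of_ball_subset hconv
    (lt_min hr hs) ((Metric.ball_subset_ball (min_le_left r s)).trans hxr)
    ((Metric.ball_subset_ball (min_le_right r s)).trans hys)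

lemma kobayashiDist_comm (D : Set (EuclideanSpace ℂ (Fin n)))
    (x y : EuclideanSpace ℂ (Fin n)) : kobayashiDist D x y = kobayashiDist D y x := by
  rw [kobayashiDist, kobayashiEDist_comm, kobayashiDist]

lemma kobayashiDist_triangle (hopen : IsOpen D) (hconv : Convex ℝ D) (hx : x ∈ D) (hy : y ∈ D)
    (hz : z ∈ D) : kobayashiDist D x z ≤ kobayashiDist D x y + kobayashiDist D y z :=
  ENNReal.toReal_le_add (kobayashiEDist_triangle D x y z) (kobayashiEDist_ne_top hopen hconv hx hy)
    (kobayashiEDist_ne_top hopen hconv hy hz)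

lemma le_kobayashiDist (hopen : IsOpen D) (hconv : Convex ℝ D) (hx : x ∈ D) (hy : y ∈ D) {r : ℝ}
    (h : ENNReal.ofReal r ≤ kobayashiEDist D x y) : r ≤ kobayashiDist D x y :=
  (ENNReal.ofReal_le_iff_le_toReal (kobayashiEDist_ne_top hopen hconv hx hy)).1 h

lemma kobayashiDist_le_of_ball_subset (hconv : Convex ℝ D) {r : ℝ} (hr : 0 < r)
    (hx : Metric.ball x r ⊆ D) (hy : Metric.ball y r ⊆ D) :
    kobayashiDist D x y ≤ dist x y / r :=
  ENNReal.toReal_le_of_le_ofReal (by positivity) (kobayashiEDist_le_of_ball_subset hconv hr hx hy)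

lemma enorm_sub_le_mul_kobayashiEDist (hopen : IsOpen D) {R : ℝ} (hR : 0 < R)
    (hD : ∀ x ∈ D, ∀ y ∈ D, dist x y ≤ R) (x y : EuclideanSpace ℂ (Fin n)) :
    ‖y - x‖ₑ ≤ ENNReal.ofReal R * kobayashiEDist D x y := by
  refine le_mul_kobayashiEDist (ENNReal.ofReal_pos.2 hR).ne' ENNReal.ofReal_ne_top fun γ hγ => ?_
  simpa only [id, hγ.source, hγ.target] using hγ.enorm_comp_sub_le hopen differentiableOn_id
    (fun z _ X => by simpa using enorm_le_mul_kobayashiMetric hR hD z X) le_rfl zero_le_one le_rfl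

lemma exists_pos_dist_le_mul_kobayashiDist (hopen : IsOpen D) (hconv : Convex ℝ D)
    (hbdd : Bornology.IsBounded D) :
    ∃ R > 0, ∀ x ∈ D, ∀ y ∈ D, dist x y ≤ R * kobayashiDist D x y := by
  have hR : 0 < Metric.diam D + 1 := by positivity
  refine ⟨Metric.diam D + 1, hR, fun x hx y hy => ?_⟩
  have hle := ENNReal.toReal_mono (ENNReal.mul_ne_top ENNReal.ofReal_ne_top
    (kobayashiEDist_ne_top hopen hconv hx hy)) <| enorm_sub_le_mul_kobayashiEDist hopen hR
    (fun x hx y hy => (Metric.dist_le_diam_of_mem hbdd hx hy).trans (le_add_of_nonneg_right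
      zero_le_one)) x y
  rwa [ENNReal.toReal_mul, ENNReal.toReal_ofReal hR.le, toReal_enorm, ← dist_eq_norm,
    dist_comm] at hle

lemma tendsto_kobayashiDist_nhds (hopen : IsOpen D) (hconv : Convex ℝ D) (hz : z ∈ D) :
    Tendsto (fun x => kobayashiDist D x z) (𝓝 z) (𝓝 0) := by
  obtain ⟨r, hr, hball⟩ := Metric.isOpen_iff.1 hopen z hz
  have hlim : Tendsto (fun x => dist x z / (r / 2)) (𝓝 z) (𝓝 0) := by
    simpa using (tendsto_iff_dist_tendsto_zero.1 (tendsto_id (x := 𝓝 z))).div_const (r / 2)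
  refine squeeze_zero' (Eventually.of_forall fun _ => ENNReal.toReal_nonneg) ?_ hlim
  filter_upwards [Metric.ball_mem_nhds z (half_pos hr)] with x hx
  exact kobayashiDist_le_of_ball_subset hconv (half_pos hr)
    ((Metric.ball_subset (by linarith [Metric.mem_ball.1 hx])).trans hball)
    ((Metric.ball_subset_ball (half_le_self hr.le)).trans hball)

end KobayashiDist

section BoundaryDist

variable {n : ℕ} {D : Set (EuclideanSpace ℂ (Fin n))} {x y z o p : EuclideanSpace ℂ (Fin n)}

lemma boundaryDist_pos (hopen : IsOpen D) (hDc : Dᶜ.Nonempty) (hz : z ∈ D) :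
    0 < boundaryDist D z :=
  (hopen.isClosed_compl.notMem_iff_infDist_pos hDc).1 (notMem_compl_iff.2 hz)

lemma tendsto_boundaryDist_nhdsWithin (hopen : IsOpen D) (hp : p ∉ D) :
    Tendsto (boundaryDist D) (𝓝[D] p) (𝓝[>] 0) := by
  refine tendsto_nhdsWithin_iff.2 ⟨?_, ?_⟩
  · rw [← Metric.infDist_zero_of_mem (mem_compl hp)]
    exact (Metric.continuous_infDist_pt Dᶜ).continuousAt.tendsto.mono_left nhdsWithin_le_nhds
  · exact eventually_mem_nhdsWithin.mono fun z hz => boundaryDist_pos hopen ⟨p, hp⟩ hz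

lemma exists_isSupportingFunctional_dist_eq_boundaryDist (hne : D.Nonempty) (hopen : IsOpen D)
    (hconv : Convex ℝ D) (hDc : Dᶜ.Nonempty) (x : EuclideanSpace ℂ (Fin n)) :
    ∃ w f, IsSupportingFunctional D w f ∧ dist w x = boundaryDist D x := by
  obtain ⟨w, hw, hdist⟩ := hopen.isClosed_compl.exists_infDist_eq_dist hDc x
  obtain ⟨f, hf⟩ := exists_isSupportingFunctional hne hopen hconv hw
  exact ⟨w, f, hf, (dist_comm w x).trans hdist.symm⟩

lemma IsSupportingFunctional.log_norm_apply_le {f : StrongDual ℂ (EuclideanSpace ℂ (Fin n))}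
    {w : EuclideanSpace ℂ (Fin n)} (hf : IsSupportingFunctional D w f) (hopen : IsOpen D)
    (hx : x ∈ D) (hw : dist w x = boundaryDist D x) :
    Real.log ‖f (w - x)‖ ≤ Real.log (boundaryDist D x) :=
  Real.log_le_log ((hf.re_pos hopen hx).trans_le (Complex.re_le_norm _))
    ((hf.norm_apply_le _).trans_eq ((dist_eq_norm w x).symm.trans hw))

lemma half_log_boundaryDist_sub_le_kobayashiDist (hopen : IsOpen D) (hconv : Convex ℝ D)
    (hDc : Dᶜ.Nonempty) (hx : x ∈ D) (hy : y ∈ D) :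
    1 / 2 * (Real.log (boundaryDist D x) - Real.log (boundaryDist D y)) ≤
      kobayashiDist D x y := by
  obtain ⟨w, f, hf, hw⟩ :=
    exists_isSupportingFunctional_dist_eq_boundaryDist ⟨x, hx⟩ hopen hconv hDc y
  have hlog := le_kobayashiDist hopen hconv hx hy <| half_abs_log_sub_le_kobayashiEDist hopen
    (g := fun z => f (w - z)) (by fun_prop) (fun z hz => hf.re_pos hopen hz) x y
  have hlogx : Real.log (boundaryDist D x) ≤ Real.log ‖f (w - x)‖ :=
    have hδ := boundaryDist_pos hopen hDc hx
    Real.log_le_log hδ ((hf.le_re_of_ball_subset hδ Metric.ball_infDist_compl_subset).trans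
      (Complex.re_le_norm _))
  have hlogy := hf.log_norm_apply_le hopen hy hw
  linarith [neg_le_abs (Real.log ‖f (w - y)‖ - Real.log ‖f (w - x)‖)]

lemma tendsto_kobayashiDist_atTop (hopen : IsOpen D) (hconv : Convex ℝ D) (ho : o ∈ D)
    (hp : p ∉ D) : Tendsto (kobayashiDist D o) (𝓝[D] p) atTop := by
  have hlog := Real.tendsto_log_nhdsGT_zero.comp (tendsto_boundaryDist_nhdsWithin hopen hp)
  have hlim : Tendsto (fun z => 1 / 2 * (Real.log (boundaryDist D o) - Real.log (boundaryDist D z)))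
      (𝓝[D] p) atTop :=
    (tendsto_atTop_add_const_left _ _ (tendsto_neg_atBot_atTop.comp hlog)).const_mul_atTop
      one_half_pos
  exact tendsto_atTop_mono' _ (eventually_mem_nhdsWithin.mono fun z hz =>
    half_log_boundaryDist_sub_le_kobayashiDist hopen hconv ⟨p, hp⟩ ho hz) hlim

lemma isCompleteHyperbolic (hopen : IsOpen D) (hconv : Convex ℝ D) (hbdd : Bornology.IsBounded D) :
    IsCompleteHyperbolic D := by
  obtain ⟨R, hR, hdist⟩ := exists_pos_dist_le_mul_kobayashiDist hopen hconv hbdd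
  refine ⟨fun x hx y hy h0 => dist_le_zero.1 (by simpa only [h0, mul_zero] using hdist x hx y hy),
    fun u hu hcauchy => ?_⟩
  have hu_cauchy : CauchySeq u := Metric.cauchySeq_iff.2 fun ε hε => by
    obtain ⟨N, hN⟩ := hcauchy (ε / R) (by positivity)
    exact ⟨N, fun k hk l hl => (hdist _ (hu k) _ (hu l)).trans_lt
      ((lt_div_iff₀' hR).1 (hN k hk l hl))⟩
  obtain ⟨z, hz⟩ := cauchySeq_tendsto_of_complete hu_cauchy
  suffices hzD : z ∈ D from ⟨z, hzD, (tendsto_kobayashiDist_nhds hopen hconv hzD).comp hz⟩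
  by_contra hzD
  obtain ⟨N, hN⟩ := hcauchy 1 one_pos
  have hatTop := (tendsto_kobayashiDist_atTop hopen hconv (hu N) hzD).comp
    (tendsto_nhdsWithin_iff.2 ⟨hz, Eventually.of_forall hu⟩)
  obtain ⟨k, hk, hNk⟩ := ((hatTop.eventually_ge_atTop 1).and (eventually_ge_atTop N)).exists
  exact (hN N le_rfl k hNk).not_ge hk

end BoundaryDist

section LogEstimate

variable {n : ℕ} {D : Set (EuclideanSpace ℂ (Fin n))} {o p q : EuclideanSpace ℂ (Fin n)}

lemma logEstimate_iff :
    LogEstimate D p q ↔ ∃ C : ℝ, ∀ᶠ z in 𝓝[D] p ×ˢ 𝓝[D] q,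
      -(1 / 2 * Real.log (boundaryDist D z.1)) - 1 / 2 * Real.log (boundaryDist D z.2) -
        kobayashiDist D z.1 z.2 ≤ C := by
  rw [LogEstimate, limsup_coe_ereal_lt_top_iff]
  simp only [one_div, Real.log_inv, mul_neg, sub_eq_add_neg]

lemma gromovProductBounded_iff :
    GromovProductBounded D o p q ↔
      ∃ C : ℝ, ∀ᶠ z in 𝓝[D] p ×ˢ 𝓝[D] q, gromovProduct D o z.1 z.2 ≤ C :=
  limsup_coe_ereal_lt_top_iff

lemma eventually_mem_and_dist_lt (D : Set (EuclideanSpace ℂ (Fin n)))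
    (p : EuclideanSpace ℂ (Fin n)) {r : ℝ} (hr : 0 < r) :
    ∀ᶠ x in 𝓝[D] p, x ∈ D ∧ dist x p < r :=
  eventually_mem_nhdsWithin.and (nhdsWithin_le_nhds (Metric.ball_mem_nhds p hr))

lemma logEstimate_of_hasDisjointSupportingHyperplanes (hopen : IsOpen D) (hconv : Convex ℝ D)
    (hbdd : Bornology.IsBounded D) (hp : p ∉ D) (hq : q ∉ D)
    (hpq : HasDisjointSupportingHyperplanes D p q) : LogEstimate D p q := by
  obtain ⟨c, hc, hor⟩ := hpq.exists_pos_le_norm_or hbdd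
  refine logEstimate_iff.2 ⟨-Real.log c, ?_⟩
  filter_upwards [(eventually_mem_and_dist_lt D p (half_pos hc)).prod_mk
    (eventually_mem_and_dist_lt D q (half_pos hc))] with ⟨x, y⟩ ⟨⟨hx, hxp⟩, hy, hyq⟩
  obtain ⟨w, f, hf, hw⟩ :=
    exists_isSupportingFunctional_dist_eq_boundaryDist ⟨x, hx⟩ hopen hconv ⟨p, hp⟩ x
  obtain ⟨w', g, hg, hw'⟩ :=
    exists_isSupportingFunctional_dist_eq_boundaryDist ⟨x, hx⟩ hopen hconv ⟨p, hp⟩ y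
  have hwx : dist w x < c / 2 :=
    (hw.trans_le (Metric.infDist_le_dist_of_mem (mem_compl hp))).trans_lt hxp
  have hwy : dist w' y < c / 2 :=
    (hw'.trans_le (Metric.infDist_le_dist_of_mem (mem_compl hq))).trans_lt hyq
  have hsum := le_kobayashiDist hopen hconv hx hy <|
    half_log_sub_add_half_log_sub_le_kobayashiEDist hopen
      (g₁ := fun z => f (w - z)) (by fun_prop) (fun z hz => hf.re_pos hopen hz)
      (g₂ := fun z => g (w' - z)) (by fun_prop) (fun z hz => hg.re_pos hopen hz) hc
      (hor w w' f g hf hg (by linarith [dist_triangle w x p]) (by linarith [dist_triangle w' y q]))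
      (((hf.norm_apply_le _).trans_eq (dist_eq_norm w x).symm).trans_lt (by linarith))
      (((hg.norm_apply_le _).trans_eq (dist_eq_norm w' y).symm).trans_lt (by linarith))
  linarith [hf.log_norm_apply_le hopen hx hw, hg.log_norm_apply_le hopen hy hw']

lemma LogEstimate.gromovProductBounded (hlog : LogEstimate D p q) (hopen : IsOpen D)
    (hconv : Convex ℝ D) (hgrowth : HasLogGrowth D (1 / 2)) (ho : o ∈ D) :
    GromovProductBounded D o p q := by
  obtain ⟨-, x₀, hx₀, A, hA⟩ := hgrowth
  have hk (z : EuclideanSpace ℂ (Fin n)) (hz : z ∈ D) : kobayashiDist D o z ≤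
      kobayashiDist D o x₀ + A - 1 / 2 * Real.log (boundaryDist D z) := by
    have hgr := hA (mem_image_of_mem _ hz)
    simp only [one_div, Real.log_inv] at hgr
    linarith [kobayashiDist_triangle hopen hconv ho hx₀ hz]
  obtain ⟨C, hC⟩ := logEstimate_iff.1 hlog
  refine gromovProductBounded_iff.2 ⟨kobayashiDist D o x₀ + A + 1 / 2 * C, ?_⟩
  filter_upwards [hC, (eventually_mem_nhdsWithin (a := p) (s := D)).prod_mk
    (eventually_mem_nhdsWithin (a := q) (s := D))] with ⟨x, y⟩ hxy ⟨hx, hy⟩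
  rw [gromovProduct, kobayashiDist_comm D x o]
  linarith [hk x hx, hk y hy]

end LogEstimate

section Multiface

variable {n : ℕ} {D : Set (EuclideanSpace ℂ (Fin n))} {a b p q w : EuclideanSpace ℂ (Fin n)}
  {f : StrongDual ℂ (EuclideanSpace ℂ (Fin n))}

lemma IsSupportingFunctional.mem_frontier_of_apply_eq_zero (hf : IsSupportingFunctional D w f)
    (hopen : IsOpen D) (ha : a ∈ closure D) (hfa : f (w - a) = 0) : a ∈ frontier D := by
  rw [hopen.frontier_eq]
  exact ⟨ha, hf.notMem_of_apply_eq_zero hopen hfa⟩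

lemma IsSupportingFunctional.mem_multiface_of_sub_mem_span (hf : IsSupportingFunctional D w f)
    (hopen : IsOpen D) (ha : a ∈ closure D) (hb : b ∈ closure D) (hfa : f (w - a) = 0)
    {u : EuclideanSpace ℂ (Fin n)} (hu : u ≠ 0) (hfu : f u = 0)
    (hab : b - a ∈ Submodule.span ℂ {u}) : b ∈ multiface D a := by
  let L : AffineSubspace ℂ (EuclideanSpace ℂ (Fin n)) := .mk' a (Submodule.span ℂ {u})
  have hfL (z) (hz : z ∈ L) : f (w - z) = 0 := by
    obtain ⟨c, hc⟩ := Submodule.mem_span_singleton.1 (AffineSubspace.mem_mk'.1 hz)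
    rw [vsub_eq_sub] at hc
    rw [← sub_sub_sub_cancel_right w z a, ← hc, map_sub, map_smul, hfa, hfu, smul_zero, sub_zero]
  have haL : a ∈ L := AffineSubspace.self_mem_mk' a _
  have hbL : b ∈ L := AffineSubspace.mem_mk'.2 hab
  have haF := hf.mem_frontier_of_apply_eq_zero hopen ha hfa
  have hbF := hf.mem_frontier_of_apply_eq_zero hopen hb (hfL b hbL)
  refine ⟨L ∩ frontier D, ⟨⟨L, ?_, ?_, ⟨a, haL, haF⟩, rfl⟩, haL, haF⟩, hbL, hbF⟩
  · rw [AffineSubspace.direction_mk', finrank_span_singleton hu]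
  · exact eq_empty_of_forall_notMem fun z hz =>
      hf.notMem_of_apply_eq_zero hopen (hfL z hz.1) hz.2

lemma IsSupportingFunctional.mem_multiface_of_ne (hf : IsSupportingFunctional D w f)
    (hopen : IsOpen D) (ha : a ∈ closure D) (hb : b ∈ closure D) (hfa : f (w - a) = 0)
    (hfb : f (w - b) = 0) (hab : b ≠ a) : b ∈ multiface D a :=
  hf.mem_multiface_of_sub_mem_span hopen ha hb hfa (sub_ne_zero.2 hab)
    (by rw [← sub_sub_sub_cancel_left a b w, map_sub, hfa, hfb, sub_zero])
    (Submodule.mem_span_singleton_self _)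

lemma IsSupportingFunctional.mem_multiface_of_two_le (hf : IsSupportingFunctional D w f)
    (hopen : IsOpen D) (hn : 2 ≤ n) (ha : a ∈ closure D) (hb : b ∈ closure D) (hfa : f (w - a) = 0)
    (hfb : f (w - b) = 0) : b ∈ multiface D a := by
  rcases eq_or_ne b a with rfl | hab
  · obtain ⟨u, hu, hfu⟩ := exists_ne_zero_apply_eq_zero (by rwa [finrank_euclideanSpace_fin]) f
    exact hf.mem_multiface_of_sub_mem_span hopen hb hb hfb hu hfu (by simp)
  · exact hf.mem_multiface_of_ne hopen ha hb hfa hfb hab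

lemma hasDisjointSupportingHyperplanes_of_le_one (hn : n ≤ 1) (hpq : n = 1 → p ≠ q) :
    HasDisjointSupportingHyperplanes D p q := by
  intro f g hf hg z _ hfz hgz
  have hrank : Module.finrank ℂ (EuclideanSpace ℂ (Fin n)) ≤ 1 := by
    rwa [finrank_euclideanSpace_fin]
  have hf0 : f ≠ 0 := norm_ne_zero_iff.1 (hf.norm_eq_one ▸ one_ne_zero)
  have hg0 : g ≠ 0 := norm_ne_zero_iff.1 (hg.norm_eq_one ▸ one_ne_zero)
  have hpz : p = z := sub_eq_zero.1 (eq_zero_of_apply_eq_zero hrank hf0 hfz)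
  have hqz : q = z := sub_eq_zero.1 (eq_zero_of_apply_eq_zero hrank hg0 hgz)
  have hn1 : n ≠ 1 := fun h => hpq h (hpz.trans hqz.symm)
  obtain rfl : n = 0 := by lia
  exact hf0 (Subsingleton.elim f 0)

lemma hasDisjointSupportingHyperplanes_of_disjoint_multiface (hopen : IsOpen D)
    (hp : p ∈ frontier D) (hq : q ∈ frontier D) (hpq : n = 1 → p ≠ q)
    (hF : multiface D p ∩ multiface D q = ∅) : HasDisjointSupportingHyperplanes D p q := by
  rcases le_or_gt n 1 with hn | hn
  · exact hasDisjointSupportingHyperplanes_of_le_one hn hpq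
  · intro f g hf hg z hz hfz hgz
    have hzF : z ∈ multiface D p ∩ multiface D q :=
      ⟨hf.mem_multiface_of_two_le hopen hn (frontier_subset_closure hp) hz (by simp) hfz,
        hg.mem_multiface_of_two_le hopen hn (frontier_subset_closure hq) hz (by simp) hgz⟩
    exact (hF ▸ hzF : z ∈ (∅ : Set _))

lemma hasDisjointSupportingHyperplanes_of_multiface_subset (hopen : IsOpen D)
    (hp : p ∈ frontier D) (hq : q ∈ frontier D) (hqp : q ≠ p) (hF : multiface D p ⊆ {p}) :
    HasDisjointSupportingHyperplanes D p q := by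
  intro f g hf hg z hz hfz hgz
  have hpD := frontier_subset_closure hp
  obtain rfl : z = p := by
    by_contra hzp
    exact hzp (hF (hf.mem_multiface_of_ne hopen hpD hz (by simp) hfz hzp))
  exact hqp (hF (hg.mem_multiface_of_ne hopen hz (frontier_subset_closure hq) hgz (by simp) hqp))

lemma logEstimate_of_disjoint_multiface (hopen : IsOpen D) (hconv : Convex ℝ D)
    (hbdd : Bornology.IsBounded D) (hp : p ∈ frontier D) (hq : q ∈ frontier D)
    (hpq : n = 1 → p ≠ q) (hF : multiface D p ∩ multiface D q = ∅) : LogEstimate D p q :=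
  have hdisj := disjoint_frontier_iff_isOpen.2 hopen
  logEstimate_of_hasDisjointSupportingHyperplanes hopen hconv hbdd (hdisj.notMem_of_mem_left hp)
    (hdisj.notMem_of_mem_left hq)
    (hasDisjointSupportingHyperplanes_of_disjoint_multiface hopen hp hq hpq hF)

lemma logEstimate_of_multiface_subset (hopen : IsOpen D) (hconv : Convex ℝ D)
    (hbdd : Bornology.IsBounded D) (hp : p ∈ frontier D) (hF : multiface D p ⊆ {p})
    (hq : q ∈ frontier D) (hqp : q ≠ p) : LogEstimate D p q :=
  have hdisj := disjoint_frontier_iff_isOpen.2 hopen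
  logEstimate_of_hasDisjointSupportingHyperplanes hopen hconv hbdd (hdisj.notMem_of_mem_left hp)
    (hdisj.notMem_of_mem_left hq)
    (hasDisjointSupportingHyperplanes_of_multiface_subset hopen hp hq hqp hF)

end Multiface

section Visibility

variable {n : ℕ} {D : Set (EuclideanSpace ℂ (Fin n))} {o p q r x y z : EuclideanSpace ℂ (Fin n)}
  {L : ℝ} {σ : ℝ → EuclideanSpace ℂ (Fin n)}

lemma kobayashiDist_le_gromovProduct_add_gromovProduct (hopen : IsOpen D) (hconv : Convex ℝ D)
    (ho : o ∈ D) (hx : x ∈ D) (hy : y ∈ D)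
    (hz : kobayashiDist D x y = kobayashiDist D x z + kobayashiDist D z y) :
    kobayashiDist D o z ≤ gromovProduct D o x z + gromovProduct D o z y := by
  simp only [gromovProduct, kobayashiDist_comm D z o]
  linarith [kobayashiDist_triangle hopen hconv hx ho hy]

lemma eventually_kobayashiDist_ne_add (hopen : IsOpen D) (hconv : Convex ℝ D) (ho : o ∈ D)
    (hr : r ∉ D) (hpr : GromovProductBounded D o p r) (hrq : GromovProductBounded D o r q) :
    ∀ᶠ a in (𝓝[D] p ×ˢ 𝓝[D] q) ×ˢ 𝓝[D] r, kobayashiDist D a.1.1 a.1.2 ≠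
      kobayashiDist D a.1.1 a.2 + kobayashiDist D a.2 a.1.2 := by
  obtain ⟨C₁, hC₁⟩ := gromovProductBounded_iff.1 hpr
  obtain ⟨C₂, hC₂⟩ := gromovProductBounded_iff.1 hrq
  have hfst : Tendsto (fun a : (_ × _) × _ => a.1.1) ((𝓝[D] p ×ˢ 𝓝[D] q) ×ˢ 𝓝[D] r) (𝓝[D] p) :=
    tendsto_fst.comp tendsto_fst
  have hsnd : Tendsto (fun a : (_ × _) × _ => a.1.2) ((𝓝[D] p ×ˢ 𝓝[D] q) ×ˢ 𝓝[D] r) (𝓝[D] q) :=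
    tendsto_snd.comp tendsto_fst
  filter_upwards [(hfst.prodMk tendsto_snd).eventually hC₁,
    (tendsto_snd.prodMk hsnd).eventually hC₂,
    hfst.eventually eventually_mem_nhdsWithin, hsnd.eventually eventually_mem_nhdsWithin,
    tendsto_snd.eventually ((tendsto_kobayashiDist_atTop hopen hconv ho hr).eventually_gt_atTop
      (C₁ + C₂))] with a ha₁ ha₂ hx hy hz hadd
  linarith [kobayashiDist_le_gromovProduct_add_gromovProduct hopen hconv ho hx hy hadd]

lemma exists_nhds_kobayashiDist_ne_add (hopen : IsOpen D) (hconv : Convex ℝ D) (ho : o ∈ D)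
    {S : Set (EuclideanSpace ℂ (Fin n))} (hS : IsCompact S) (hSD : Disjoint S D)
    (hpr : ∀ r ∈ S, GromovProductBounded D o p r) (hrq : ∀ r ∈ S, GromovProductBounded D o r q) :
    ∃ U ∈ 𝓝 p, ∃ V ∈ 𝓝 q, ∃ W ∈ 𝓝ˢ S, ∀ x ∈ U ∩ D, ∀ y ∈ V ∩ D, ∀ z ∈ W ∩ D,
      kobayashiDist D x y ≠ kobayashiDist D x z + kobayashiDist D z y := by
  have hev : {a : (_ × _) × _ | a.2 ∈ D → kobayashiDist D a.1.1 a.1.2 ≠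
      kobayashiDist D a.1.1 a.2 + kobayashiDist D a.2 a.1.2} ∈
        (𝓝[D] p ×ˢ 𝓝[D] q) ×ˢ 𝓝ˢ S := by
    refine hS.mem_prod_nhdsSet_of_forall fun r hr => ?_
    obtain ⟨P, hP, Q, hQ, hPQ⟩ := eventually_prod_iff.1 <| eventually_kobayashiDist_ne_add hopen
      hconv ho (hSD.notMem_of_mem_left hr) (hpr r hr) (hrq r hr)
    exact eventually_prod_iff.2 ⟨P, hP, fun z => z ∈ D → Q z, eventually_nhdsWithin_iff.1 hQ,
      fun ha z hz hzD => hPQ ha (hz hzD)⟩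
  obtain ⟨T, hT, W, hW, hTW⟩ := mem_prod_iff.1 hev
  obtain ⟨U', hU', V', hV', hUV⟩ := mem_prod_iff.1 hT
  obtain ⟨U, hU, hUU'⟩ := mem_nhdsWithin_iff_exists_mem_nhds_inter.1 hU'
  obtain ⟨V, hV, hVV'⟩ := mem_nhdsWithin_iff_exists_mem_nhds_inter.1 hV'
  exact ⟨U, hU, V, hV, W, hW, fun x hx y hy z hz =>
    @hTW ((x, y), z) ⟨hUV ⟨hUU' hx, hVV' hy⟩, hz.1⟩ hz.2⟩

namespace IsGeodesic

lemma continuousOn (hσ : IsGeodesic D L σ) (hopen : IsOpen D) (hconv : Convex ℝ D)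
    (hbdd : Bornology.IsBounded D) : ContinuousOn σ (Icc 0 L) := by
  obtain ⟨R, hR, hdist⟩ := exists_pos_dist_le_mul_kobayashiDist hopen hconv hbdd
  refine (LipschitzOnWith.of_dist_le_mul (K := ⟨R, hR.le⟩) fun s hs t ht => ?_).continuousOn
  rw [Real.dist_eq, ← hσ.2.2 s hs t ht]
  exact hdist _ (hσ.2.1 hs) _ (hσ.2.1 ht)

lemma kobayashiDist_add (hσ : IsGeodesic D L σ) {t : ℝ} (ht : t ∈ Icc 0 L) :
    kobayashiDist D (σ 0) (σ L) = kobayashiDist D (σ 0) (σ t) + kobayashiDist D (σ t) (σ L) := by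
  have h0 : (0 : ℝ) ∈ Icc 0 L := left_mem_Icc.2 hσ.1
  have hL : L ∈ Icc 0 L := right_mem_Icc.2 hσ.1
  rw [hσ.2.2 0 h0 L hL, hσ.2.2 0 h0 t ht, hσ.2.2 t ht L hL, abs_of_nonpos (by linarith [hσ.1]),
    abs_of_nonpos (by linarith [ht.1]), abs_of_nonpos (by linarith [ht.2])]
  ring

lemma exists_dist_eq (hσ : IsGeodesic D L σ) (hopen : IsOpen D) (hconv : Convex ℝ D)
    (hbdd : Bornology.IsBounded D) {d : ℝ} (h0 : dist (σ 0) p ≤ d) (hL : d ≤ dist (σ L) p) :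
    ∃ t ∈ Icc 0 L, dist (σ t) p = d :=
  intermediate_value_Icc hσ.1 ((continuous_id.dist continuous_const).comp_continuousOn
    (hσ.continuousOn hopen hconv hbdd)) ⟨h0, hL⟩

end IsGeodesic

lemma exists_isCompact_forall_isGeodesic_inter_nonempty (hopen : IsOpen D) (hconv : Convex ℝ D)
    (hbdd : Bornology.IsBounded D) (ho : o ∈ D)
    (hG : ∀ p ∈ frontier D, ∀ q ∈ frontier D, p ≠ q → GromovProductBounded D o p q)
    (hp : p ∈ frontier D) (hq : q ∈ frontier D) (hpq : p ≠ q) :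
    ∃ U ∈ 𝓝 p, ∃ V ∈ 𝓝 q, ∃ K ⊆ D, IsCompact K ∧ ∀ (L : ℝ) (σ : ℝ → EuclideanSpace ℂ (Fin n)),
      IsGeodesic D L σ → σ 0 ∈ U → σ L ∈ V → (σ '' Icc 0 L ∩ K).Nonempty := by
  obtain ⟨d, hd0, hdq⟩ := exists_between (dist_pos.2 hpq.symm)
  have hC : IsCompact (closure D ∩ Metric.sphere p d) :=
    hbdd.isCompact_closure.inter_right Metric.isClosed_sphere
  have hS : IsCompact (frontier D ∩ Metric.sphere p d) :=
    hC.of_isClosed_subset (isClosed_frontier.inter Metric.isClosed_sphere)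
      (inter_subset_inter_left _ frontier_subset_closure)
  obtain ⟨U, hU, V, hV, W, hW, hne⟩ := exists_nhds_kobayashiDist_ne_add hopen hconv ho hS
    ((disjoint_frontier_iff_isOpen.2 hopen).mono_left inter_subset_left)
    (fun r hr => hG p hp r hr.1 (Metric.ne_of_mem_sphere hr.2 hd0.ne').symm)
    (fun r hr => hG r hr.1 q hq (ne_of_apply_ne (dist · p) (hr.2.trans_ne hdq.ne)))
  obtain ⟨O, hO, hSO, hOW⟩ := mem_nhdsSet_iff_exists.1 hW
  have hfar : {y | d < dist y p} ∈ 𝓝 q :=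
    (isOpen_lt continuous_const (continuous_id.dist continuous_const)).mem_nhds hdq
  refine ⟨U ∩ Metric.ball p d, inter_mem hU (Metric.ball_mem_nhds p hd0), V ∩ {y | d < dist y p},
    inter_mem hV hfar, (closure D ∩ Metric.sphere p d) \ O, ?_, hC.diff hO,
    fun L σ hσ ⟨h0U, h0p⟩ ⟨hLV, hLp⟩ => ?_⟩
  · intro z ⟨⟨hzD, hzp⟩, hzO⟩
    by_contra hz
    exact hzO (hSO ⟨hopen.frontier_eq ▸ ⟨hzD, hz⟩, hzp⟩)
  · obtain ⟨t, ht, htp⟩ := hσ.exists_dist_eq hopen hconv hbdd (Metric.mem_ball.1 h0p).le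
      (le_of_lt hLp)
    refine ⟨σ t, mem_image_of_mem σ ht, ⟨subset_closure (hσ.2.1 ht), htp⟩, fun htO => ?_⟩
    exact hne _ ⟨h0U, hσ.2.1 (left_mem_Icc.2 hσ.1)⟩ _ ⟨hLV, hσ.2.1 (right_mem_Icc.2 hσ.1)⟩ _
      ⟨hOW htO, hσ.2.1 ht⟩ (hσ.kobayashiDist_add ht)

lemma hasVisibleGeodesics_of_gromovProductBounded (hopen : IsOpen D) (hconv : Convex ℝ D)
    (hbdd : Bornology.IsBounded D) (ho : o ∈ D)
    (hG : ∀ p ∈ frontier D, ∀ q ∈ frontier D, p ≠ q → GromovProductBounded D o p q)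
    (hp : p ∈ frontier D) (hq : q ∈ frontier D) (hpq : p ≠ q) : HasVisibleGeodesics D p q := by
  obtain ⟨U, hU, V, hV, K, hKD, hK, hmeet⟩ :=
    exists_isCompact_forall_isGeodesic_inter_nonempty hopen hconv hbdd ho hG hp hq hpq
  obtain ⟨U', hU', V', hV', hdisj⟩ := exists_nhds_disjoint_closure hpq
  exact ⟨U ∩ U', inter_mem hU hU', V ∩ V', inter_mem hV hV',
    (hdisj.mono (closure_mono inter_subset_right) (closure_mono inter_subset_right)).inter_eq,
    K, hKD, hK, fun L σ hσ h0 hL => hmeet L σ hσ h0.1 hL.1⟩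

end Visibility

end ConvexVisibility

theorem mainTheorem8 {n : ℕ} (D : Set (EuclideanSpace ℂ (Fin n)))
    (hne : D.Nonempty) (hopen : IsOpen D) (hconv : Convex ℝ D)
    (hbdd : Bornology.IsBounded D) :
    (∀ p ∈ frontier D, ∀ q ∈ frontier D, (n = 1 → p ≠ q) →
      ConvexVisibility.multiface D p ∩ ConvexVisibility.multiface D q = ∅ →
      ConvexVisibility.LogEstimate D p q ∧
      (ConvexVisibility.HasLogGrowth D (1 / 2) →
        ∀ o ∈ D, ConvexVisibility.GromovProductBounded D o p q)) ∧
    (∀ p ∈ frontier D, ConvexVisibility.multiface D p ⊆ {p} →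
      ∀ q ∈ frontier D, q ≠ p → ConvexVisibility.LogEstimate D p q) ∧
    ((∀ p ∈ frontier D, ConvexVisibility.multiface D p ⊆ {p}) →
      ConvexVisibility.HasLogGrowth D (1 / 2) →
      ConvexVisibility.HasVisibilityProperty D) := by
  refine ⟨fun p hp q hq hpq hF => ?_,
    fun p hp hF q => ConvexVisibility.logEstimate_of_multiface_subset hopen hconv hbdd hp hF,
    fun hF hgrowth => ⟨ConvexVisibility.isCompleteHyperbolic hopen hconv hbdd,
      fun p hp q hq hpq => ?_⟩⟩
  · have hlog :=
      ConvexVisibility.logEstimate_of_disjoint_multiface hopen hconv hbdd hp hq hpq hF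
    exact ⟨hlog, fun hgrowth o ho => hlog.gromovProductBounded hopen hconv hgrowth ho⟩
  · obtain ⟨o, ho⟩ := hne
    have hgromov (a) (ha : a ∈ frontier D) (b) (hb : b ∈ frontier D) (hab : a ≠ b) :
        ConvexVisibility.GromovProductBounded D o a b :=
      (ConvexVisibility.logEstimate_of_multiface_subset hopen hconv hbdd ha (hF a ha) hb
        hab.symm).gromovProductBounded hopen hconv hgrowth ho
    exact ConvexVisibility.hasVisibleGeodesics_of_gromovProductBounded hopen hconv hbdd ho
      hgromov hp hq hpq
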